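/- Let $S^1$ be the unit circle, let $\sigma$ be a uniform measure on $S^1$ (a rotation-invariant Borel measure with $0<\sigma(S^1)<\infty$, e.g. arc length), and let $\lambda>\mu>0$. Let $\mathbb M(S^1)$ be the space of (finite) simple point measures on $S^1$, with the $\sigma$-algebra generated by the maps $\nu\mapsto\nu(B)$, $B\subseteq S^1$ Borel. For a rotation $\theta$ of $S^1$ write $\theta(\nu)(A):=\nu(\theta^{-1}(A))$, and call $f:\mathbb M(S^1)\to\mathbb M(S^1)$ rotation-equivariant if $\theta(f(\nu))=f(\theta(\nu))$ for all $\nu\in\mathbb M(S^1)$ and all rotations $\theta$. A homogeneous Poisson process of intensity $\lambda$ on $S^1$ is a Poisson point process with intensity measure $\lambda\sigma$. Let $\Pi$ be a homogeneous Poisson process of intensity $\lambda$ on $S^1$, and let $X$ and $Y$ be Poisson random variables with respective means $\lambda\,\sigma(S^1)$ and $\mu\,\sigma(S^1)$. Then the following are equivalent. (i) There exists a measurable, rotation-equivariant function $f:\mathbb M(S^1)\to\mathbb M(S^1)$ such that $f(\Pi)$ is a homogeneous Poisson process of intensity $\mu$ on $S^1$, and almost surely every point of $f(\Pi)$ is a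 point of $\Pi$. (ii) There exists an integer $k\ge 0$ such that $\mathbb P(X=k)\le \mathbb P(Y=k)$ and $\mathbb P(X\le k+1)\le \mathbb P(Y\le k)$. (iii) There is no integer $k\ge 0$ such that $\mathbb P(X=k+1)>\mathbb P(Y=k+1)$ and $\mathbb P(X\le k+1)>\mathbb P(Y\le k)$. -/

import Mathlib

open MeasureTheory ProbabilityTheory
open scoped NNReal ENNReal

/-- The Borel σ-algebra on the unit circle `S¹ = {z : ℂ | ‖z‖ = 1}`. -/
noncomputable instance Circle.instMeasurableSpaceBorel : MeasurableSpace Circle := borel Circle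

instance Circle.instBorelSpaceBorel : BorelSpace Circle := ⟨rfl⟩

/-- `ν` is a (finite) simple point measure: a finite sum of unit masses at distinct points. -/
def IsSimplePointMeasure {S : Type*} [MeasurableSpace S] (ν : Measure S) : Prop :=
  ∃ A : Finset S, ν = ∑ x ∈ A, Measure.dirac x

/-- The space `𝕄(S)` of simple point measures on `S`. As a subtype of `Measure S` it carries
the σ-algebra generated by the evaluations `ν ↦ ν B`, `B` measurable. -/
abbrev SimplePointMeasure (S : Type*) [MeasurableSpace S] : Type _ :=
  {ν : Measure S // IsSimplePointMeasure ν}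

/-- The set `[ν] = {x | ν {x} = 1}` of points of a simple point measure. -/
def SimplePointMeasure.points {S : Type*} [MeasurableSpace S] (ν : SimplePointMeasure S) :
    Set S :=
  {x | ν.1 {x} = 1}

/-- The random element `ξ` of `𝕄(S)`, defined on the probability space `(Ω, P)`, is a Poisson
point process with finite intensity measure `m`: the number of points in each measurable set `B`
is a Poisson variable with mean `m B`, and the numbers of points in finitely many pairwise
disjoint measurable sets are independent. -/
structure IsPoissonProcess {Ω S : Type*} [MeasurableSpace Ω] [MeasurableSpace S]
    (P : Measure Ω) (m : Measure S) [IsFiniteMeasure m] (ξ : Ω → SimplePointMeasure S) :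
    Prop where
  measurable : Measurable ξ
  law_count : ∀ B : Set S, MeasurableSet B → ∀ n : ℕ,
    P {ω | (ξ ω).1 B = (n : ℝ≥0∞)} = poissonMeasure (m B).toNNReal {n}
  indep : ∀ (n : ℕ) (B : Fin n → Set S), (∀ i, MeasurableSet (B i)) →
    Pairwise (fun i j => Disjoint (B i) (B j)) →
    iIndepFun (fun (i : Fin n) (ω : Ω) => (ξ ω).1 (B i)) P

theorem IsSimplePointMeasure.map_rotation {ν : Measure Circle} (hν : IsSimplePointMeasure ν)
    (θ : Circle) : IsSimplePointMeasure (ν.map (fun x => θ * x)) := by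
  classical
  obtain ⟨A, rfl⟩ := hν
  have hm : Measurable (fun x : Circle => θ * x) :=
    (continuous_const.mul continuous_id).measurable
  refine ⟨A.image (fun x => θ * x), ?_⟩
  rw [Finset.sum_image (fun x _ y _ h => mul_left_cancel h),
    ← Measure.mapₗ_apply_of_measurable hm, map_sum]
  exact Finset.sum_congr rfl fun x _ => by
    rw [Measure.mapₗ_apply_of_measurable hm, Measure.map_dirac' hm]

/-- The rotation of `S¹` by `θ`, acting on simple point measures: `θ(ν)(A) = ν(θ⁻¹(A))`. -/
noncomputable def SimplePointMeasure.rotate (θ : Circle) (ν : SimplePointMeasure Circle) :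
    SimplePointMeasure Circle :=
  ⟨ν.1.map (fun x => θ * x), ν.2.map_rotation θ⟩

/-- `f : 𝕄(S¹) → 𝕄(S¹)` commutes with all rotations of the circle. -/
def IsRotationEquivariant (f : SimplePointMeasure Circle → SimplePointMeasure Circle) : Prop :=
  ∀ (ν : SimplePointMeasure Circle) (θ : Circle), (f ν).rotate θ = f (ν.rotate θ)

/-! Given that it has n points, a Poisson process on the circle consists of n independent uniform
points (`binomialLaw`). Conversely, mixing these laws with Poisson weights gives a Poisson process
(`isPoissonProcess_of_map_eq`). Everything thus reduces to moving mass between numbers of points.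

Necessity (`IsPoissonProcess.not_exists_of_thinning`): a thinning that keeps all k + 1 points of a
configuration fixes it. Let E be the set of configurations of k + 1 points which f maps to k + 1
points. If E has positive probability, comparing input and output on E gives P(X = k + 1) ≤ P(Y = k
+ 1). If E is null, k + 1 or fewer input points almost surely leave at most k, so P(X ≤ k + 1) ≤ P(Y
≤ k).

Sufficiency: the randomness must be extracted from the configuration itself. Among n points, call
one removable if for 1 ≤ j < n the arc of j / n turns after it holds at least j others. By an
argument in the style of the cycle lemma, almost surely exactly one point is removable, and deleting
it leaves n - 1 independent uniform points (`map_thin_binomialLaw`). Given the survivors, the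
deleted point is uniform on a fundamental domain for the n-th roots of unity. For n ≥ 2, the n-th
power of the product of the survivors' quotients by the deleted point is therefore uniform and
independent of the survivors (`map_thin_mark_binomialLaw`). This rotation-invariant mark serves as
an external random variable, at the price of one deletion.

With k as in (ii), configurations of at most k points are left alone, which is affordable because
P(X = m) ≤ P(Y = m) for m ≤ k. For larger n the mark selects how many points to keep, by the
monotone coupling of the rest of the law of X with the rest of the law of Y
(`map_thinning_poissonMixture`). The second inequality of (ii), which persists for larger k
(`poissonCdf_succ_le_of_le`), ensures that this coupling always pays the price. -/

namespace SimplePointMeasure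

/-! ### Counts of simple point measures. -/

variable {S : Type*} [MeasurableSpace S]

theorem measurable_eval {B : Set S} (hB : MeasurableSet B) :
    Measurable fun ν : SimplePointMeasure S => ν.1 B :=
  (Measure.measurable_coe hB).comp measurable_subtype_coe

theorem measurable_of_eval {α : Type*} [MeasurableSpace α] {f : α → SimplePointMeasure S}
    (hf : ∀ B, MeasurableSet B → Measurable fun a => (f a).1 B) : Measurable f :=
  Measurable.subtype_mk (Measure.measurable_of_measurable_coe _ hf)

theorem exists_nat_eq (ν : SimplePointMeasure S) {B : Set S} (hB : MeasurableSet B) :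
    ∃ n : ℕ, ν.1 B = n := by
  classical
  obtain ⟨_, A, rfl⟩ := ν
  refine ⟨(A.filter (· ∈ B)).card, ?_⟩
  simp [Measure.finsetSum_apply, Measure.dirac_apply' _ hB, Set.indicator_apply]

instance (ν : SimplePointMeasure S) : IsFiniteMeasure ν.1 :=
  ⟨by obtain ⟨n, hn⟩ := ν.exists_nat_eq MeasurableSet.univ; rw [hn]; exact ENNReal.natCast_lt_top n⟩

/-- The number of points of `ν` in `B`, as a natural number. -/
noncomputable def count (ν : SimplePointMeasure S) (B : Set S) : ℕ := ⌊(ν.1 B).toReal⌋₊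

theorem natCast_count (ν : SimplePointMeasure S) {B : Set S} (hB : MeasurableSet B) :
    (ν.count B : ℝ≥0∞) = ν.1 B := by
  obtain ⟨n, hn⟩ := ν.exists_nat_eq hB
  simp [count, hn]

theorem count_eq_iff (ν : SimplePointMeasure S) {B : Set S} (hB : MeasurableSet B) {n : ℕ} :
    ν.count B = n ↔ ν.1 B = n := by
  rw [← ν.natCast_count hB, Nat.cast_inj]

theorem measurable_count {B : Set S} (hB : MeasurableSet B) :
    Measurable fun ν : SimplePointMeasure S => ν.count B :=
  Nat.measurable_floor.comp (measurable_eval hB).ennreal_toReal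

end SimplePointMeasure

/-! ### Uniqueness in law of the Poisson process. -/

namespace IsPoissonProcess

variable {Ω Ω' S : Type*} [MeasurableSpace Ω] [MeasurableSpace Ω'] [MeasurableSpace S]
  {P : Measure Ω} {P' : Measure Ω'} {m : Measure S} [IsFiniteMeasure m]
  {ξ : Ω → SimplePointMeasure S} {ξ' : Ω' → SimplePointMeasure S}

theorem measurable_eval (h : IsPoissonProcess P m ξ) {B : Set S} (hB : MeasurableSet B) :
    Measurable fun ω => (ξ ω).1 B :=
  (SimplePointMeasure.measurable_eval hB).comp h.measurable

theorem measurable_count (h : IsPoissonProcess P m ξ) {B : Set S} (hB : MeasurableSet B) :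
    Measurable fun ω => (ξ ω).count B :=
  (SimplePointMeasure.measurable_count hB).comp h.measurable

theorem map_count (h : IsPoissonProcess P m ξ) {B : Set S} (hB : MeasurableSet B) :
    P.map (fun ω => (ξ ω).count B) = poissonMeasure (m B).toNNReal := by
  refine Measure.ext_of_singleton fun n => ?_
  rw [Measure.map_apply (h.measurable_count hB) (measurableSet_singleton n), ← h.law_count B hB n]
  congr 1
  ext ω
  simp [SimplePointMeasure.count_eq_iff _ hB]

theorem map_eval (h : IsPoissonProcess P m ξ) {B : Set S} (hB : MeasurableSet B) :
    P.map (fun ω => (ξ ω).1 B) = (poissonMeasure (m B).toNNReal).map (Nat.cast : ℕ → ℝ≥0∞) := by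
  rw [← h.map_count hB, Measure.map_map .of_discrete (h.measurable_count hB)]
  congr 1
  ext ω
  simp [SimplePointMeasure.natCast_count _ hB]

theorem iIndepFun_eval (h : IsPoissonProcess P m ξ) {ι : Type*} [Fintype ι] {B : ι → Set S}
    (hB : ∀ i, MeasurableSet (B i)) (hd : Pairwise fun i j => Disjoint (B i) (B j)) :
    iIndepFun (fun i ω => (ξ ω).1 (B i)) P := by
  have e := Fintype.equivFin ι
  have := h.indep _ (fun i => B (e.symm i)) (fun i => hB _)
    (fun i j hij => hd fun h' => hij (e.symm.injective h'))
  simpa using this.precomp e.injective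

theorem map_eval_pi [IsProbabilityMeasure P] (h : IsPoissonProcess P m ξ) {ι : Type*} [Fintype ι]
    {B : ι → Set S}
    (hB : ∀ i, MeasurableSet (B i)) (hd : Pairwise fun i j => Disjoint (B i) (B j)) :
    P.map (fun ω i => (ξ ω).1 (B i)) =
      Measure.pi fun i => (poissonMeasure (m (B i)).toNNReal).map (Nat.cast : ℕ → ℝ≥0∞) := by
  rw [(iIndepFun_iff_map_fun_eq_pi_map fun i =>
    (h.measurable_eval (hB i)).aemeasurable).1
    (h.iIndepFun_eval hB hd)]
  congr 1
  ext1 i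
  exact h.map_eval (hB i)

/-- The law of a Poisson process is determined by its intensity measure. -/
theorem map_eq_map [IsProbabilityMeasure P] [IsProbabilityMeasure P']
    (h : IsPoissonProcess P m ξ) (h' : IsPoissonProcess P' m ξ') : P.map ξ = P'.map ξ' := by
  classical
  let e : SimplePointMeasure S → ({s : Set S // MeasurableSet s} → ℝ≥0∞) := fun ν s => ν.1 s.1
  have he : Measurable e := measurable_pi_lambda _ fun s => SimplePointMeasure.measurable_eval s.2
  have key : (P.map ξ).map e = (P'.map ξ').map e := by
    have : IsProbabilityMeasure ((P.map ξ).map e) := by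
      have := Measure.isProbabilityMeasure_map (μ := P) h.measurable.aemeasurable
      exact Measure.isProbabilityMeasure_map he.aemeasurable
    refine IsProjectiveLimit.unique (P := fun I => ((P.map ξ).map e).map I.restrict)
      (fun I => rfl) fun I => ?_
    -- The finitely many sets in `I` may overlap. Their atoms are disjoint, so the joint law of the
    -- atom counts is known, and `g` recovers the original counts as sums over atoms.
    let atom : (I → Bool) → Set S := fun J => {x | ∀ C : I, x ∈ C.1.1 ↔ J C = true}
    have hatom : ∀ J, MeasurableSet (atom J) := fun J => by
      have : atom J = ⋂ C : I, {x | x ∈ C.1.1 ↔ J C = true} := by ext; simp [atom]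
      rw [this]
      refine MeasurableSet.iInter fun C => ?_
      by_cases hC : J C = true
      · simp only [hC, iff_true]
        exact C.1.2
      · simp only [hC, Bool.false_eq_true, iff_false]
        exact C.1.2.compl
    have hdisj : Pairwise fun J K => Disjoint (atom J) (atom K) := fun J K hJK => by
      refine Set.disjoint_left.2 fun x hx hx' => hJK ?_
      ext1 C
      have := (hx C).symm.trans (hx' C)
      exact Bool.eq_iff_iff.2 this
    let g : ((I → Bool) → ℝ≥0∞) → (I → ℝ≥0∞) := fun v C => ∑ J with J C = true, v J
    have hg : Measurable g := by
      refine measurable_pi_lambda _ fun C => ?_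
      exact Finset.measurable_fun_sum _ fun J _ => measurable_pi_apply J
    have hfac : ∀ ν : SimplePointMeasure S, I.restrict (e ν) = g fun J => ν.1 (atom J) := by
      intro ν
      ext C
      have hC : C.1.1 = ⋃ J ∈ Finset.univ.filter (fun J : I → Bool => J C = true), atom J := by
        ext x
        simp only [Finset.mem_filter, Finset.mem_univ, true_and, Set.mem_iUnion, exists_prop]
        constructor
        · intro hx
          exact ⟨fun C' => decide (x ∈ C'.1.1), by simpa using hx, fun C' => by simp⟩
        · rintro ⟨J, hJ, hx⟩
          exact (hx C).2 hJ
      change ν.1 C.1.1 = _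
      rw [hC, measure_biUnion_finset (fun J _ K _ hJK => hdisj hJK) fun J _ => hatom J]
    have hr : Measurable (I.restrict (π := fun _ : {s : Set S // MeasurableSet s} => ℝ≥0∞)) :=
      Finset.measurable_restrict I
    have aux : ∀ R : Measure (SimplePointMeasure S), (R.map e).map I.restrict =
        (R.map fun ν J => ν.1 (atom J)).map g := by
      intro R
      rw [Measure.map_map hr he, Measure.map_map hg
        (measurable_pi_lambda _ fun J => SimplePointMeasure.measurable_eval (hatom J))]
      congr 1
      ext1 ν
      exact hfac _
    have hm : Measurable fun (ν : SimplePointMeasure S) (J : I → Bool) => ν.1 (atom J) :=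
      measurable_pi_lambda _ fun J => SimplePointMeasure.measurable_eval (hatom J)
    change ((P'.map ξ').map e).map I.restrict = ((P.map ξ).map e).map I.restrict
    rw [aux, aux, Measure.map_map hm h.measurable, Measure.map_map hm h'.measurable]
    congr 1
    exact (h'.map_eval_pi hatom hdisj).trans (h.map_eval_pi hatom hdisj).symm
  -- The evaluations generate the σ-algebra, so agreement of the two laws after `e` is agreement of
  -- the laws.
  have hle : (inferInstance : MeasurableSpace (SimplePointMeasure S)) ≤
      MeasurableSpace.comap e MeasurableSpace.pi := by
    have hid : @Measurable _ _ (MeasurableSpace.comap e MeasurableSpace.pi) _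
        (id : SimplePointMeasure S → SimplePointMeasure S) := by
      refine @SimplePointMeasure.measurable_of_eval S _ _ (MeasurableSpace.comap e MeasurableSpace.pi)
        _ fun B hB => ?_
      exact (measurable_pi_apply (⟨B, hB⟩ : {s : Set S // MeasurableSet s})).comp
        (comap_measurable e)
    intro s hs
    simpa using hid hs
  ext s hs
  obtain ⟨t, ht, rfl⟩ := hle s hs
  rw [← Measure.map_apply he ht, ← Measure.map_apply he ht, key]

end IsPoissonProcess

/-! ### Poisson mixtures of independent points. -/

section MixedBinomial

variable {S : Type*} [MeasurableSpace S]

theorem isSimplePointMeasure_zero : IsSimplePointMeasure (0 : Measure S) := ⟨∅, by simp⟩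

theorem isSimplePointMeasure_sum_dirac {n : ℕ} {x : Fin n → S} (hx : Function.Injective x) :
    IsSimplePointMeasure (∑ i, Measure.dirac (x i)) :=
  ⟨Finset.univ.map ⟨x, hx⟩, by simp⟩

open Classical in
/-- The simple point measure with points `x 0, …, x (n - 1)` if these are distinct, and the zero
measure otherwise. -/
noncomputable def SimplePointMeasure.ofFn {n : ℕ} (x : Fin n → S) : SimplePointMeasure S :=
  if hx : Function.Injective x then ⟨_, isSimplePointMeasure_sum_dirac hx⟩
  else ⟨0, isSimplePointMeasure_zero⟩

theorem SimplePointMeasure.ofFn_apply {n : ℕ} {x : Fin n → S} (hx : Function.Injective x) :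
    (ofFn x).1 = ∑ i, Measure.dirac (x i) := by
  simp [ofFn, hx]

theorem measurableSet_injective [MeasurableEq S] (n : ℕ) :
    MeasurableSet {x : Fin n → S | Function.Injective x} := by
  have : {x : Fin n → S | Function.Injective x} = ⋂ (i) (j) (_ : i ≠ j), {x | x i = x j}ᶜ := by
    ext x
    simp only [Set.mem_ofPred_eq, Set.mem_iInter, Set.mem_compl_iff]
    exact ⟨fun h i j hij h' => hij (h h'), fun h i j h' => by_contra fun hij => h i j hij h'⟩
  rw [this]
  exact MeasurableSet.iInter fun i => MeasurableSet.iInter fun j => MeasurableSet.iInter fun _ =>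
    (measurableSet_eq_fun (measurable_pi_apply i) (measurable_pi_apply j)).compl

theorem SimplePointMeasure.measurable_ofFn [MeasurableEq S] (n : ℕ) :
    Measurable (ofFn : (Fin n → S) → SimplePointMeasure S) := by
  classical
  refine measurable_of_eval fun B hB => ?_
  have : (fun x : Fin n → S => (ofFn x).1 B) = fun x =>
      if Function.Injective x then ∑ i, B.indicator 1 (x i) else 0 := by
    ext x
    by_cases hx : Function.Injective x
    · simp [ofFn_apply hx, hx, Measure.finsetSum_apply, Measure.dirac_apply' _ hB]
    · simp [ofFn, hx]
  rw [this]
  refine Measurable.ite (measurableSet_injective n) ?_ measurable_const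
  exact Finset.measurable_fun_sum _ fun i _ =>
    (measurable_one.indicator hB).comp (measurable_pi_apply i)

/-- The law of the point process formed by `n` independent points with law `U`. -/
noncomputable def binomialLaw (U : Measure S) (n : ℕ) : Measure (SimplePointMeasure S) :=
  (Measure.pi fun _ : Fin n => U).map SimplePointMeasure.ofFn

/-- The law of the point process formed by a Poisson number of independent points. -/
noncomputable def poissonMixture (U : Measure S) (a : ℝ≥0) : Measure (SimplePointMeasure S) :=
  Measure.sum fun n => poissonMeasure a {n} • binomialLaw U n

theorem ae_injective_pi [MeasurableEq S] (U : Measure S) [IsProbabilityMeasure U] [NullSingletonClass U]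
    (n : ℕ) : ∀ᵐ x ∂Measure.pi fun _ : Fin n => U, Function.Injective x := by
  have h : ∀ i j : Fin n, i ≠ j → ∀ᵐ x ∂Measure.pi fun _ : Fin n => U, x i ≠ x j := by
    intro i j hij
    have hind := (iIndepFun_pi (μ := fun _ : Fin n => U) (X := fun _ => id)
      fun _ => aemeasurable_id).indepFun hij
    have hmap := (indepFun_iff_map_prod_eq_prod_map_map (measurable_pi_apply i).aemeasurable
      (measurable_pi_apply j).aemeasurable).1 hind
    have e : ∀ k : Fin n, (Measure.pi fun _ : Fin n => U).map (fun x => x k) = U := fun k =>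
      (measurePreserving_eval (fun _ : Fin n => U) k).map_eq
    have hmap' : (Measure.pi fun _ : Fin n => U).map (fun x => (x i, x j)) = U.prod U := by
      simpa [e] using hmap
    have h0 : (U.prod U) (Set.diagonal S) = 0 := by
      rw [Measure.measure_prod_null measurableSet_diagonal]
      refine Filter.Eventually.of_forall fun x => ?_
      have : Prod.mk x ⁻¹' Set.diagonal S = {x} := by ext y; simp [eq_comm]
      change U (Prod.mk x ⁻¹' Set.diagonal S) = 0
      rw [this]
      simp
    rw [← hmap', Measure.map_apply ((measurable_pi_apply i).prodMk (measurable_pi_apply j))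
      measurableSet_diagonal] at h0
    filter_upwards [measure_eq_zero_iff_ae_notMem.1 h0] with x hx
    simpa using hx
  have h' : ∀ᵐ x ∂Measure.pi fun _ : Fin n => U, ∀ i j : Fin n, i ≠ j → x i ≠ x j := by
    simp only [ae_all_iff]
    exact h
  filter_upwards [h'] with x hx i j hij
  exact by_contra fun hne => hx i j hne hij

variable [MeasurableEq S] {U : Measure S} [IsProbabilityMeasure U]

instance (n : ℕ) : IsProbabilityMeasure (binomialLaw U n) :=
  Measure.isProbabilityMeasure_map (SimplePointMeasure.measurable_ofFn n).aemeasurable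

theorem tsum_poissonMeasure (a : ℝ≥0) : ∑' n, poissonMeasure a {n} = 1 := by
  rw [← measure_iUnion (fun i j hij => by simpa using hij) fun n => measurableSet_singleton n]
  exact (congrArg _ (Set.iUnion_of_singleton ℕ)).trans measure_univ

instance (a : ℝ≥0) : IsProbabilityMeasure (poissonMixture U a) :=
  ⟨by simp [poissonMixture, Measure.sum_apply _ MeasurableSet.univ, tsum_poissonMeasure]⟩

variable [NullSingletonClass U]

theorem hasSum_poissonMeasure_pow (a : ℝ≥0) (z : ℂ) :
    HasSum (fun n => ((poissonMeasure a).real {n} : ℂ) * z ^ n) (Complex.exp (a * (z - 1))) := by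
  have h := (NormedSpace.expSeries_div_hasSum_exp ((a : ℂ) * z)).mul_left (Complex.exp (-a))
  rw [← Complex.exp_eq_exp_ℂ, ← Complex.exp_add] at h
  convert! h using 1
  · ext n
    rw [poissonMeasure_real_singleton]
    push_cast
    rw [mul_pow]
    ring
  · congr 1
    ring

variable {ι : Type*} [Fintype ι] {B : ι → Set S}

/-- For n independent points the characteristic function of the counts is an n-th power. Averaging
over n by the Poisson generating function gives the exponential of a sum over the sets, hence a
product. -/
theorem integral_exp_poissonMixture (a : ℝ≥0) (hB : ∀ i, MeasurableSet (B i))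
    (hd : Pairwise fun i j => Disjoint (B i) (B j)) (t : ι → ℝ) :
    ∫ ν, Complex.exp ((∑ i, (ν.1 (B i)).toReal * t i : ℝ) * Complex.I) ∂poissonMixture U a =
      ∏ i, Complex.exp ((a * U.real (B i) : ℝ) * (Complex.exp (t i * Complex.I) - 1)) := by
  classical
  set F : SimplePointMeasure S → ℂ :=
    fun ν => Complex.exp ((∑ i, (ν.1 (B i)).toReal * t i : ℝ) * Complex.I) with hF
  have hFm : Measurable F := by
    have : Measurable fun ν : SimplePointMeasure S => ∑ i, (ν.1 (B i)).toReal * t i :=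
      Finset.measurable_fun_sum _ fun i _ =>
        (SimplePointMeasure.measurable_eval (hB i)).ennreal_toReal.mul_const _
    exact Complex.measurable_exp.comp ((Complex.measurable_ofReal.comp this).mul_const _)
  have hFb : ∀ ν, ‖F ν‖ ≤ 1 := fun ν => (Complex.norm_exp_ofReal_mul_I _).le
  have hFi : ∀ (R : Measure (SimplePointMeasure S)) [IsFiniteMeasure R], Integrable F R :=
    fun R _ => Integrable.of_bound hFm.aestronglyMeasurable 1 (Filter.Eventually.of_forall hFb)
  set φ : S → ℂ := fun y => 1 + ∑ i, (B i).indicator 1 y * (Complex.exp (t i * Complex.I) - 1)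
    with hφ
  -- By disjointness at most one indicator is nonzero at `y`, so the additive and exponential forms
  -- agree.
  have hφ_eq : ∀ y, φ y = Complex.exp ((∑ i, (B i).indicator 1 y * t i : ℝ) * Complex.I) := by
    intro y
    by_cases hy : ∃ i, y ∈ B i
    · obtain ⟨i, hi⟩ := hy
      have hne : ∀ j, j ≠ i → y ∉ B j := fun j hj hyj => Set.disjoint_left.1 (hd hj) hyj hi
      rw [hφ]
      dsimp only
      rw [Finset.sum_eq_single i (fun j _ hj => by simp [hne j hj]) (by simp),
        Finset.sum_eq_single i (fun j _ hj => by simp [hne j hj]) (by simp)]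
      simp [hi]
    · push Not at hy
      simp [hφ, hy]
  have hFx : ∀ {n} (x : Fin n → S), Function.Injective x →
      F (SimplePointMeasure.ofFn x) = ∏ l, φ (x l) := by
    intro n x hx
    simp only [hF, hφ_eq, SimplePointMeasure.ofFn_apply hx]
    rw [← Complex.exp_sum, ← Finset.sum_mul, ← Complex.ofReal_sum, Finset.sum_comm]
    congr 4
    ext i
    rw [← Finset.sum_mul, Measure.finsetSum_apply, ENNReal.toReal_sum fun l _ => measure_ne_top _ _]
    congr 2
    ext l
    rw [Measure.dirac_apply' _ (hB i)]
    by_cases h : x l ∈ B i <;> simp [h]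
  have hβ : ∀ n, ∫ ν, F ν ∂binomialLaw U n = (∫ y, φ y ∂U) ^ n := by
    intro n
    rw [binomialLaw, integral_map (SimplePointMeasure.measurable_ofFn n).aemeasurable
      hFm.aestronglyMeasurable]
    rw [integral_congr_ae (g := fun x => ∏ l, φ (x l))]
    · rw [integral_fin_nat_prod_eq_prod (μ := fun _ : Fin n => U) fun _ => φ]
      simp
    · filter_upwards [ae_injective_pi U n] with x hx using hFx x hx
  have hφi : ∫ y, φ y ∂U = 1 + ∑ i, (U.real (B i) : ℂ) * (Complex.exp (t i * Complex.I) - 1) := by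
    have hi : ∀ i, Integrable (fun y => (B i).indicator (1 : S → ℂ) y) U := fun i =>
      (integrable_const (1 : ℂ)).indicator (hB i)
    rw [hφ, integral_add (integrable_const _)
      (integrable_finsetSum _ fun i _ => (hi i).mul_const _),
      integral_finsetSum _ fun i _ => (hi i).mul_const _]
    congr 1
    · simp
    · refine Finset.sum_congr rfl fun i _ => ?_
      rw [integral_mul_const]
      congr 1
      rw [integral_indicator (hB i)]; simp
  have : IsFiniteMeasure (Measure.sum fun n => poissonMeasure a {n} • binomialLaw U n) :=
    inferInstanceAs (IsFiniteMeasure (poissonMixture U a))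
  have hsum : HasSum (fun n => ∫ ν, F ν ∂(poissonMeasure a {n} • binomialLaw U n))
      (∫ ν, F ν ∂poissonMixture U a) := hasSum_integral_measure (hFi (Measure.sum _))
  rw [hsum.unique (a₂ := Complex.exp (a * ((∫ y, φ y ∂U) - 1)))]
  · rw [hφi, ← Complex.exp_sum, add_sub_cancel_left, Finset.mul_sum]
    congr 2
    ext i
    push_cast
    ring
  · convert! hasSum_poissonMeasure_pow a (∫ y, φ y ∂U) using 2 with n
    rw [integral_smul_measure, hβ]
    simp [Measure.real]

/-- A point process with a Poisson number of independent points is a Poisson process. -/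
theorem isPoissonProcess_of_map_eq {Ω : Type*} [MeasurableSpace Ω] {P : Measure Ω}
    [IsProbabilityMeasure P] {m : Measure S} [IsFiniteMeasure m] {a : ℝ≥0} (hm : m = a • U)
    {ξ : Ω → SimplePointMeasure S} (hξ : Measurable ξ) (h : P.map ξ = poissonMixture U a) :
    IsPoissonProcess P m ξ := by
  classical
  have hmeas : ∀ {B : Set S}, MeasurableSet B → Measurable fun ω => ((ξ ω).1 B).toReal :=
    fun hB => ((SimplePointMeasure.measurable_eval hB).comp hξ).ennreal_toReal
  -- This formula serves twice: for one set it identifies the law of the count, and for several sets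
  -- its product form is independence.
  have key : ∀ (n : ℕ) (B : Fin n → Set S), (∀ i, MeasurableSet (B i)) →
      (Pairwise fun i j => Disjoint (B i) (B j)) → ∀ t : Fin n → ℝ,
      ∫ ω, Complex.exp ((∑ i, ((ξ ω).1 (B i)).toReal * t i : ℝ) * Complex.I) ∂P =
      ∏ i, Complex.exp ((a * U.real (B i) : ℝ) * (Complex.exp (t i * Complex.I) - 1)) := by
    intro n B hB hd t
    rw [← integral_exp_poissonMixture a hB hd t, ← h, integral_map hξ.aemeasurable]
    have : Measurable fun ν : SimplePointMeasure S => ∑ i, (ν.1 (B i)).toReal * t i :=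
      Finset.measurable_fun_sum _ fun i _ =>
        (SimplePointMeasure.measurable_eval (hB i)).ennreal_toReal.mul_const _
    exact (Complex.measurable_exp.comp
      ((Complex.measurable_ofReal.comp this).mul_const _)).aestronglyMeasurable
  have hchar : ∀ {B : Set S}, MeasurableSet B → ∀ t : ℝ,
      charFun (P.map fun ω => ((ξ ω).1 B).toReal) t =
      Complex.exp ((a * U.real B : ℝ) * (Complex.exp (t * Complex.I) - 1)) := by
    intro B hB t
    have := key 1 (fun _ => B) (fun _ => hB) (fun i j hij => (hij (Subsingleton.elim _ _)).elim)
      fun _ => t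
    simp only [Finset.univ_unique, Finset.sum_singleton, Finset.prod_singleton] at this
    rw [← this, charFun_apply, integral_map (hmeas hB).aemeasurable (by fun_prop)]
    simp only [Real.inner_apply]
  have hlaw : ∀ {B : Set S}, MeasurableSet B → P.map (fun ω => ((ξ ω).1 B).toReal) =
      (poissonMeasure (m B).toNNReal).map (Nat.cast : ℕ → ℝ) := by
    intro B hB
    have := Measure.isProbabilityMeasure_map (μ := P) (hmeas hB).aemeasurable
    refine Measure.ext_of_charFun (funext fun t => ?_)
    rw [hchar hB, charFun_map_cast_poissonMeasure]
    congr 2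
    rw [hm, Measure.smul_apply, Measure.real]
    simp [ENNReal.smul_def, ENNReal.toReal]
  refine ⟨hξ, fun B hB n => ?_, fun n B hB hd => ?_⟩
  · have hl := congrArg (fun R => R {(n : ℝ)}) (hlaw hB)
    rw [Measure.map_apply (hmeas hB) (measurableSet_singleton _),
      Measure.map_apply .of_discrete (measurableSet_singleton _)] at hl
    have e1 : (fun ω => ((ξ ω).1 B).toReal) ⁻¹' {(n : ℝ)} = {ω | (ξ ω).1 B = n} := by
      ext ω
      obtain ⟨k, hk⟩ := (ξ ω).exists_nat_eq hB
      simp [hk]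
    have e2 : (Nat.cast : ℕ → ℝ) ⁻¹' {(n : ℝ)} = {n} := by ext; simp
    rwa [e1, e2] at hl
  · have hind : iIndepFun (fun i ω => ((ξ ω).1 (B i)).toReal) P := by
      rw [iIndepFun_iff_charFun_pi fun i => (hmeas (hB i)).aemeasurable]
      intro t
      have hv : Measurable fun ω => WithLp.toLp 2 fun i => ((ξ ω).1 (B i)).toReal :=
        (WithLp.measurable_toLp 2 _).comp (measurable_pi_lambda _ fun i => hmeas (hB i))
      simp only [hchar (hB _)]
      rw [← key n B hB hd fun i => t i, charFun_apply, integral_map hv.aemeasurable (by fun_prop)]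
      simp [PiLp.inner_apply, mul_comm]
    have := hind.comp (fun _ => ENNReal.ofReal) fun _ => ENNReal.measurable_ofReal
    convert! this using 3 with i ω
    simp [ENNReal.ofReal_toReal (measure_ne_top _ _)]

end MixedBinomial

/-! ### Comparison of two Poisson laws. -/

section PoissonArithmetic

/-- The Poisson probability of the value `n`. -/
noncomputable def poissonProb (a : ℝ≥0) (n : ℕ) : ℝ := (poissonMeasure a).real {n}

/-- The Poisson probability of the values smaller than `n`. -/
noncomputable def poissonCdf (a : ℝ≥0) (n : ℕ) : ℝ := ∑ i ∈ Finset.range n, poissonProb a i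

theorem poissonProb_eq (a : ℝ≥0) (n : ℕ) :
    poissonProb a n = Real.exp (-a) * a ^ n / (n.factorial : ℝ) :=
  poissonMeasure_real_singleton a n

theorem poissonProb_nonneg (a : ℝ≥0) (n : ℕ) : 0 ≤ poissonProb a n := measureReal_nonneg

theorem poissonProb_pos {a : ℝ≥0} (ha : 0 < a) (n : ℕ) : 0 < poissonProb a n :=
  poissonMeasure_real_singleton_pos n ha

theorem ofReal_poissonProb (a : ℝ≥0) (n : ℕ) :
    ENNReal.ofReal (poissonProb a n) = poissonMeasure a {n} := by
  rw [poissonProb, Measure.real, ENNReal.ofReal_toReal (measure_ne_top _ _)]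

theorem poissonProb_succ (a : ℝ≥0) (n : ℕ) :
    poissonProb a (n + 1) = poissonProb a n * (a / (n + 1)) := by
  rw [poissonProb_eq, poissonProb_eq, Nat.factorial_succ, pow_succ]
  push_cast
  field_simp

theorem hasSum_poissonProb (a : ℝ≥0) : HasSum (poissonProb a) 1 := by
  rw [show poissonProb a = _ from funext (poissonProb_eq a)]
  exact hasSum_one_poissonMeasure a

theorem poissonCdf_succ (a : ℝ≥0) (n : ℕ) :
    poissonCdf a (n + 1) = poissonCdf a n + poissonProb a n := Finset.sum_range_succ _ _

theorem poissonCdf_mono (a : ℝ≥0) : Monotone (poissonCdf a) :=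
  monotone_nat_of_le_succ fun n => by
    rw [poissonCdf_succ]; linarith [poissonProb_nonneg a n]

theorem tendsto_poissonCdf (a : ℝ≥0) :
    Filter.Tendsto (poissonCdf a) Filter.atTop (nhds 1) := (hasSum_poissonProb a).tendsto_sum_nat

theorem poissonCdf_le_one (a : ℝ≥0) (n : ℕ) : poissonCdf a n ≤ 1 :=
  (poissonCdf_mono a).ge_of_tendsto (tendsto_poissonCdf a) n

theorem poissonMeasure_real_Iio (a : ℝ≥0) (n : ℕ) :
    (poissonMeasure a).real (Set.Iio n) = poissonCdf a n := by
  rw [poissonCdf]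
  simp only [poissonProb]
  rw [sum_measureReal_singleton, Finset.coe_range]

variable {a b : ℝ≥0}

/-- The likelihood ratio of the two laws is multiplied by a / b > 1 at each step, so being at most 1
passes to smaller values. -/
theorem poissonProb_le_of_le (hab : b < a) {m n : ℕ} (hmn : m ≤ n)
    (h : poissonProb a n ≤ poissonProb b n) : poissonProb a m ≤ poissonProb b m := by
  induction n, hmn using Nat.le_induction with
  | base => exact h
  | succ n _ ih =>
    refine ih ?_
    rw [poissonProb_succ, poissonProb_succ] at h
    have hab' : (b : ℝ) < a := hab
    have hn : (0 : ℝ) < n + 1 := by positivity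
    by_contra! hlt
    have h1 : (b : ℝ) / (n + 1) < a / (n + 1) := by gcongr
    have h2 := mul_lt_mul'' hlt h1 (poissonProb_nonneg b n) (by positivity)
    linarith

theorem exists_poissonProb_lt (hab : b < a) :
    ∃ n, poissonProb b n < poissonProb a n := by
  by_contra! h
  have h0 : poissonProb a 0 < poissonProb b 0 := by
    simpa [poissonProb_eq] using hab
  exact (hasSum_lt h h0 (hasSum_poissonProb a) (hasSum_poissonProb b)).false

/-- Once `P(X ≤ n) ≤ P(Y < n)`, this persists for all larger `n`. -/
theorem poissonCdf_succ_le_of_le (hb : 0 < b) (hab : b < a) {n : ℕ}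
    (h : poissonCdf a (n + 1) ≤ poissonCdf b n) {m : ℕ} (hm : n ≤ m) :
    poissonCdf a (m + 1) ≤ poissonCdf b m := by
  have hb' : (0 : ℝ) < b := hb
  have hab' : (b : ℝ) < a := hab
  induction m, hm using Nat.le_induction with
  | base => exact h
  | succ n _ h =>
  by_contra! hlt
  -- Put D n = `poissonCdf b n - poissonCdf a (n + 1)`. Then D falls from n to n + 1 exactly when r
  -- n > 1. The quotient r (n + 1) / r n increases with n, so once r has risen it never falls again.
  set r : ℕ → ℝ := fun n => poissonProb a (n + 1) / poissonProb b n with hr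
  have hbp := poissonProb_pos hb
  have hrpos : ∀ n, 0 < r n := fun n => div_pos (poissonProb_pos (hb.trans hab) _) (hbp n)
  have hrs : ∀ n, r (n + 1) = r n * (a * (n + 1) / (b * (n + 2))) := by
    intro n
    simp only [hr]
    rw [poissonProb_succ a (n + 1), poissonProb_succ b n]
    have := (hbp n).ne'
    push_cast
    field_simp
    ring
  have hrn : 1 < r n := by
    rw [hr, one_lt_div (hbp n)]
    rw [poissonCdf_succ a (n + 1), poissonCdf_succ b n] at hlt
    linarith
  -- D is negative at 0 and nonnegative at n, so it must have risen somewhere before n.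
  obtain ⟨i, hin, hi⟩ : ∃ i < n, r i < 1 := by
    by_contra! hge
    have : ∀ i ≤ n, poissonCdf b i < poissonCdf a (i + 1) := by
      intro i
      induction i with
      | zero =>
        intro _
        simpa [poissonCdf] using poissonProb_pos (hb.trans hab) 0
      | succ i ih =>
        intro hi
        have h1 := hge i hi
        rw [hr, one_le_div (hbp i)] at h1
        rw [poissonCdf_succ b i, poissonCdf_succ a (i + 1)]
        linarith [ih (by omega)]
    linarith [this n le_rfl]
  obtain ⟨l, hln, hl⟩ : ∃ l < n, r l ≤ r (l + 1) := by
    by_contra! hdec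
    have : ∀ j, i ≤ j → j ≤ n → r j ≤ r i := by
      intro j hij
      induction j, hij using Nat.le_induction with
      | base => intro _; exact le_rfl
      | succ j _ ih => intro hj; exact (hdec j hj).le.trans (ih (by omega))
    linarith [this n hin.le le_rfl]
  have hl' : (b : ℝ) * (l + 2) ≤ a * (l + 1) := by
    rw [hrs, le_mul_iff_one_le_right (hrpos l), one_le_div (by positivity)] at hl
    exact hl
  have hmono : ∀ j, n ≤ j → 1 < r j := by
    intro j hj
    induction j, hj using Nat.le_induction with
    | base => exact hrn
    | succ j hj ih =>
      refine ih.trans_le ?_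
      rw [hrs, le_mul_iff_one_le_right (hrpos j), one_le_div (by positivity)]
      have : (l : ℝ) ≤ j := by exact_mod_cast hln.le.trans hj
      nlinarith
  -- From n + 1 on, D stays below its negative value there, although it tends to 0.
  have hanti : ∀ j, n + 1 ≤ j → poissonCdf b j - poissonCdf a (j + 1) ≤
      poissonCdf b (n + 1) - poissonCdf a (n + 1 + 1) := by
    intro j hj
    induction j, hj using Nat.le_induction with
    | base => exact le_rfl
    | succ j hj ih =>
      have h1 := hmono j (by omega)
      rw [hr, one_lt_div (hbp j)] at h1
      rw [poissonCdf_succ b j, poissonCdf_succ a (j + 1)]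
      linarith
  have hlim : Filter.Tendsto (fun j => poissonCdf b j - poissonCdf a (j + 1)) Filter.atTop
      (nhds (1 - 1)) :=
    (tendsto_poissonCdf b).sub ((tendsto_poissonCdf a).comp (Filter.tendsto_add_atTop_nat 1))
  have := le_of_tendsto hlim (Filter.eventually_atTop.2 ⟨n + 1, hanti⟩)
  linarith

/-- The first inequality passes to smaller k and the second to larger k. The decisive k is thus the
last one before the first law overtakes the second pointwise. -/
theorem exists_poissonProb_le_iff (hb : 0 < b) (hab : b < a) :
    (∃ k, poissonProb a k ≤ poissonProb b k ∧ poissonCdf a (k + 2) ≤ poissonCdf b (k + 1)) ↔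
    ¬ ∃ k, poissonProb b (k + 1) < poissonProb a (k + 1) ∧
      poissonCdf b (k + 1) < poissonCdf a (k + 2) := by
  constructor
  · rintro ⟨k, hk, hk'⟩ ⟨j, hj, hj'⟩
    have hkj : k ≤ j := by
      by_contra! hlt
      exact absurd (poissonProb_le_of_le hab hlt hk) (not_le.2 hj)
    exact absurd (poissonCdf_succ_le_of_le hb hab hk' (m := j + 1) (by omega)) (not_le.2 hj')
  · intro h
    classical
    have hex := exists_poissonProb_lt hab
    -- The overtaking does not happen at 0, where the masses are exp (-a) ≤ exp (-b).
    obtain ⟨k, hk⟩ : ∃ k, Nat.find hex = k + 1 := by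
      refine Nat.exists_eq_succ_of_ne_zero fun h0 => ?_
      have := Nat.find_spec hex
      rw [h0] at this
      refine absurd this (not_lt.2 ?_)
      simpa [poissonProb_eq] using hab.le
    refine ⟨k, not_lt.1 (Nat.find_min hex (by omega)), ?_⟩
    by_contra! hlt
    exact h ⟨k, hk ▸ Nat.find_spec hex, hlt⟩

end PoissonArithmetic

/-! ### Necessity: comparing input and output of a thinning. -/

section Necessity

variable {S : Type*} [MeasurableSpace S]

namespace SimplePointMeasure

theorem exists_finset [MeasurableSingletonClass S] (ν : SimplePointMeasure S) :
    ∃ A : Finset S, ν.1 = ∑ x ∈ A, Measure.dirac x ∧ ν.points = A := by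
  classical
  obtain ⟨_, A, rfl⟩ := ν
  refine ⟨A, rfl, ?_⟩
  ext x
  simp [points, Measure.finsetSum_apply, Set.indicator_apply]

theorem eq_of_points_subset [MeasurableSingletonClass S] {ν ν' : SimplePointMeasure S}
    (h : ν'.points ⊆ ν.points) (hle : ν.count Set.univ ≤ ν'.count Set.univ) : ν' = ν := by
  obtain ⟨A, hA, hA'⟩ := ν.exists_finset
  obtain ⟨B, hB, hB'⟩ := ν'.exists_finset
  rw [hA', hB', Finset.coe_subset] at h
  have e := Finset.eq_of_subset_of_card_le h (by simpa [count, hA, hB] using hle)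
  exact Subtype.ext (by rw [hA, hB, e])

theorem count_univ_le_of_points_subset [MeasurableSingletonClass S] {ν ν' : SimplePointMeasure S}
    (h : ν'.points ⊆ ν.points) : ν'.count Set.univ ≤ ν.count Set.univ := by
  obtain ⟨A, hA, hA'⟩ := ν.exists_finset
  obtain ⟨B, hB, hB'⟩ := ν'.exists_finset
  rw [hA', hB', Finset.coe_subset] at h
  simpa [count, hA, hB] using Finset.card_le_card h

theorem count_univ_ofFn {n : ℕ} {x : Fin n → S} (hx : Function.Injective x) :
    (ofFn x).count Set.univ = n := by
  simp [count, ofFn_apply hx]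

end SimplePointMeasure

theorem IsPoissonProcess.measureReal_count_univ {S Ω : Type*} [MeasurableSpace S]
    [MeasurableSpace Ω] {P : Measure Ω} {U m : Measure S} [IsProbabilityMeasure U]
    [IsFiniteMeasure m] {a : ℝ≥0} {ξ : Ω → SimplePointMeasure S} (hm : m = a • U)
    (h : IsPoissonProcess P m ξ)
    (s : Set ℕ) : P.real {ω | (ξ ω).count Set.univ ∈ s} = (poissonMeasure a).real s := by
  have hu : (m Set.univ).toNNReal = a := by
    rw [hm, Measure.smul_apply, measure_univ, ENNReal.smul_def, smul_eq_mul, mul_one,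
      ENNReal.toNNReal_coe]
  have := h.map_count MeasurableSet.univ
  rw [hu] at this
  rw [Measure.real, Measure.real, ← this,
    Measure.map_apply (h.measurable_count .univ) (.of_discrete)]
  rfl

variable [MeasurableEq S] {U : Measure S} [IsProbabilityMeasure U] [NullSingletonClass U]

theorem ae_count_univ_binomialLaw (n : ℕ) :
    ∀ᵐ ν ∂binomialLaw U n, ν.count Set.univ = n := by
  rw [binomialLaw, ae_map_iff (SimplePointMeasure.measurable_ofFn n).aemeasurable
    (measurableSet_eq_fun (SimplePointMeasure.measurable_count .univ) measurable_const)]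
  filter_upwards [ae_injective_pi U n] with x hx using SimplePointMeasure.count_univ_ofFn hx

theorem poissonMixture_inter_count_eq (a : ℝ≥0) {E : Set (SimplePointMeasure S)}
    (hE : MeasurableSet E) {n : ℕ} (hn : ∀ ν ∈ E, ν.count Set.univ = n) :
    poissonMixture U a E = poissonMeasure a {n} * binomialLaw U n E := by
  rw [poissonMixture, Measure.sum_apply _ hE, tsum_eq_single n]
  · simp
  · intro m hm
    have : binomialLaw U m E = 0 := measure_mono_null 
      (fun ν hν (h : ν.count Set.univ = m) => hm (h.symm.trans (hn ν hν)))
      (ae_count_univ_binomialLaw (U := U) m)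
    simp [this]

variable {Ω : Type*} [MeasurableSpace Ω] {P : Measure Ω} [IsProbabilityMeasure P]
    {a b : ℝ≥0} {m m' : Measure S} [IsFiniteMeasure m] [IsFiniteMeasure m']
    {ξ ζ : Ω → SimplePointMeasure S}

theorem IsPoissonProcess.map_eq_poissonMixture (hm : m = a • U) (h : IsPoissonProcess P m ξ) :
    P.map ξ = poissonMixture U a := by
  have := h.map_eq_map (isPoissonProcess_of_map_eq hm measurable_id
    (Measure.map_id (μ := poissonMixture U a)))
  rwa [Measure.map_id] at this

theorem IsPoissonProcess.not_exists_of_thinning (hm : m = a • U) (hm' : m' = b • U)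
    (hξ : IsPoissonProcess P m ξ) {f : SimplePointMeasure S → SimplePointMeasure S}
    (hf : Measurable f) (hfξ : IsPoissonProcess P m' fun ω => f (ξ ω))
    (hsub : ∀ᵐ ω ∂P, (f (ξ ω)).points ⊆ (ξ ω).points) :
    ¬ ∃ k, poissonProb b (k + 1) < poissonProb a (k + 1) ∧
      poissonCdf b (k + 1) < poissonCdf a (k + 2) := by
  rintro ⟨k, hk, hk'⟩
  let E : Set (SimplePointMeasure S) :=
    {ν | ν.count Set.univ = k + 1} ∩ {ν | (f ν).count Set.univ = k + 1}
  have hE : MeasurableSet E :=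
    (measurableSet_eq_fun (SimplePointMeasure.measurable_count .univ) measurable_const).inter
    (measurableSet_eq_fun ((SimplePointMeasure.measurable_count .univ).comp hf) measurable_const)
  have e1 : P {ω | ξ ω ∈ E} = poissonMeasure a {k + 1} * binomialLaw U (k + 1) E := by
    rw [← poissonMixture_inter_count_eq a hE fun ν hν => hν.1, ← hξ.map_eq_poissonMixture hm,
      Measure.map_apply hξ.measurable hE]
    rfl
  have e2 : P {ω | f (ξ ω) ∈ E} = poissonMeasure b {k + 1} * binomialLaw U (k + 1) E := by
    rw [← poissonMixture_inter_count_eq b hE fun ν hν => hν.1, ← hfξ.map_eq_poissonMixture hm',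
      Measure.map_apply hfξ.measurable hE]
    rfl
  -- On E no point is deleted, so the output equals the input and lies in E too.
  have hle : P {ω | ξ ω ∈ E} ≤ P {ω | f (ξ ω) ∈ E} := by
    refine measure_mono_ae ?_
    filter_upwards [hsub] with ω hω hωE
    have : f (ξ ω) = ξ ω := SimplePointMeasure.eq_of_points_subset hω (hωE.1.trans hωE.2.symm).le
    change f (ξ ω) ∈ E
    rw [this]
    exact hωE
  -- Were E null, at most k + 1 input points would almost surely leave at most k, against the
  -- assumed inequality of distribution functions.
  have hpos : P {ω | ξ ω ∈ E} ≠ 0 := by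
    intro h0
    have h1 := hξ.measureReal_count_univ hm (Set.Iio (k + 2))
    have h2 := hfξ.measureReal_count_univ hm' (Set.Iio (k + 1))
    rw [poissonMeasure_real_Iio] at h1 h2
    have : P {ω | (ξ ω).count Set.univ ∈ Set.Iio (k + 2)} ≤
        P {ω | (f (ξ ω)).count Set.univ ∈ Set.Iio (k + 1)} := by
      refine measure_mono_ae ?_
      filter_upwards [hsub, measure_eq_zero_iff_ae_notMem.1 h0] with ω hω hωE hlt
      have hc := SimplePointMeasure.count_univ_le_of_points_subset hω
      change (f (ξ ω)).count Set.univ < k + 1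
      have hlt' : (ξ ω).count Set.univ < k + 2 := hlt
      by_contra! hge
      exact hωE ⟨show (ξ ω).count Set.univ = k + 1 by omega,
        show (f (ξ ω)).count Set.univ = k + 1 by omega⟩
    have := ENNReal.toReal_mono (measure_ne_top _ _) this
    rw [← measureReal_def, ← measureReal_def, h1, h2] at this
    linarith
  rw [e1] at hpos
  rw [e1, e2, ← ofReal_poissonProb, ← ofReal_poissonProb] at hle
  have hβ := right_ne_zero_of_mul hpos
  have := (ENNReal.mul_le_mul_iff_left hβ (measure_ne_top _ _)).1 hle
  exact absurd ((ENNReal.ofReal_le_ofReal_iff (poissonProb_nonneg _ _)).1 this) (not_le.2 hk)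

end Necessity

/-! ### Angles, arcs and the uniform law on the circle. -/

section Angle

namespace Circle

/-- The angle of a point of the circle, in full turns, between `0` and `1`. -/
noncomputable def turn (z : Circle) : ℝ := Int.fract (Complex.arg z / (2 * Real.pi))

theorem turn_nonneg (z : Circle) : 0 ≤ turn z := Int.fract_nonneg _

theorem turn_lt_one (z : Circle) : turn z < 1 := Int.fract_lt_one _

theorem measurable_turn : Measurable turn := by
  have hc : Continuous fun z : Circle => (z : ℂ) := continuous_subtype_val
  have h := hc.measurable
  exact measurable_fract.comp ((Complex.measurable_arg.comp h).div_const _)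

theorem exp_two_pi_mul_turn (z : Circle) : exp (2 * Real.pi * turn z) = z := by
  rw [turn, Int.fract, mul_sub, Circle.exp_sub, exp_two_pi_mul_int, div_one,
    mul_div_cancel₀ _ (by positivity), exp_arg]

theorem turn_exp (t : ℝ) : turn (exp (2 * Real.pi * t)) = Int.fract t := by
  have h := exp_two_pi_mul_turn (exp (2 * Real.pi * t))
  obtain ⟨m, hm⟩ := exp_eq_exp.1 h
  have h2 : turn (exp (2 * Real.pi * t)) = t + m := by
    have := Real.pi_pos
    have h3 : 2 * Real.pi * (turn (exp (2 * Real.pi * t)) - t - m) = 0 := by linarith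
    rcases mul_eq_zero.1 h3 with h4 | h4
    · exact absurd h4 (by positivity)
    · linarith
  rw [← Int.fract_add_intCast t m, ← h2, eq_comm, Int.fract_eq_self]
  exact ⟨turn_nonneg _, turn_lt_one _⟩

theorem turn_eq_zero {z : Circle} : turn z = 0 ↔ z = 1 := by
  constructor
  · intro h
    rw [← exp_two_pi_mul_turn z, h, mul_zero, exp_zero]
  · rintro rfl
    simpa using turn_exp 0

theorem turn_div (u v : Circle) :
    turn (u / v) = turn u - turn v + if turn u < turn v then 1 else 0 := by
  have h : u / v = exp (2 * Real.pi * (turn u - turn v)) := by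
    rw [mul_sub, Circle.exp_sub, exp_two_pi_mul_turn, exp_two_pi_mul_turn]
  rw [h, turn_exp]
  have := turn_nonneg u
  have := turn_nonneg v
  have := turn_lt_one u
  have := turn_lt_one v
  split_ifs with hlt
  · rw [Int.fract_eq_iff]
    exact ⟨by linarith, by linarith, -1, by simp⟩
  · rw [Int.fract_eq_iff]
    exact ⟨by linarith, by linarith, 0, by simp⟩

/-- The points reached from `x` by a positive rotation of at most `t` turns. -/
def arc (x : Circle) (t : ℝ) : Set Circle := {y | 0 < turn (y / x) ∧ turn (y / x) ≤ t}

theorem mem_arc_mul {θ x y : Circle} {t : ℝ} : θ * y ∈ arc (θ * x) t ↔ y ∈ arc x t := by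
  simp [arc, mul_div_mul_left_eq_div]

theorem notMem_arc_self (x : Circle) (t : ℝ) : x ∉ arc x t := by
  simp [arc, turn_eq_zero.2]

theorem measurableSet_arc_prod (t : ℝ) : MeasurableSet {p : Circle × Circle | p.2 ∈ arc p.1 t} := by
  have h : Measurable fun p : Circle × Circle => turn (p.2 / p.1) :=
    measurable_turn.comp (measurable_snd.div measurable_fst)
  exact (measurableSet_lt measurable_const h).inter (measurableSet_le h measurable_const)

theorem measurableSet_arc (x : Circle) (t : ℝ) : MeasurableSet (arc x t) :=
  measurable_prodMk_left (measurableSet_arc_prod t)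

instance : Nontrivial Circle := ⟨1, -1, fun h => by
  have := congrArg (fun z : Circle => (z : ℂ).re) h
  norm_num at this⟩

end Circle

variable (U : Measure Circle) [U.IsHaarMeasure]

/-- A power map is a surjective endomorphism of a compact group, so it preserves Haar measure. -/
theorem measurePreserving_div_pow (c : Circle) {n : ℕ} (hn : n ≠ 0) :
    MeasurePreserving (fun z : Circle => c / z ^ n) U U := by
  have h1 : MeasurePreserving (powMonoidHom n : Circle →* Circle) U U := by
    refine MonoidHom.measurePreserving (continuous_pow n) (fun z => ?_) rfl
    refine ⟨Circle.exp (Complex.arg z / n), ?_⟩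
    rw [powMonoidHom_apply, ← Circle.exp_nsmul, nsmul_eq_mul, mul_div_cancel₀ _ (by positivity),
      Circle.exp_arg]
  exact (Measure.measurePreserving_div_left U c).comp h1

/-- By uniqueness of the invariant probability, `U` is the image of Lebesgue measure under t ↦ exp
(2πit), which `Circle.turn` inverts on [0, 1). -/
theorem map_turn [IsProbabilityMeasure U] : U.map Circle.turn = volume.restrict (Set.Ico 0 1) := by
  have := Fact.mk (zero_lt_one' ℝ)
  have hc : Measurable fun t : ℝ => Circle.exp (2 * Real.pi * t) := by
    exact (Circle.exp.continuous.comp (continuous_const.mul continuous_id)).measurable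
  set V : Measure Circle := (volume.restrict (Set.Ico (0 : ℝ) 1)).map
    fun t => Circle.exp (2 * Real.pi * t) with hV
  have hprob : IsProbabilityMeasure (volume.restrict (Set.Ico (0 : ℝ) 1)) := ⟨by simp⟩
  have hVp : IsProbabilityMeasure V := Measure.isProbabilityMeasure_map hc.aemeasurable
  have hV' : V = (volume : Measure (AddCircle (1 : ℝ))).map AddCircle.toCircle := by
    rw [← (AddCircle.measurePreserving_mk 1 0).map_eq, Measure.map_map
      AddCircle.continuous_toCircle.measurable (AddCircle.measurable_mk'), zero_add,
      hV, restrict_Ico_eq_restrict_Ioc]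
    congr 1
    ext1 t
    simp [AddCircle.toCircle_apply_mk]
  have hinv : V.IsMulLeftInvariant := by
    refine ⟨fun g => ?_⟩
    obtain ⟨s, rfl⟩ : ∃ s : AddCircle (1 : ℝ), AddCircle.toCircle s = g :=
      
      ⟨_, (AddCircle.homeomorphCircle_apply one_ne_zero _).symm.trans
        ((AddCircle.homeomorphCircle one_ne_zero).apply_symm_apply g)⟩
    have hm := (AddCircle.continuous_toCircle (T := 1)).measurable
    rw [hV', Measure.map_map (measurable_const_mul _) hm]
    conv_rhs => rw [← (measurePreserving_add_left (volume : Measure (AddCircle (1 : ℝ))) s).map_eq,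
      Measure.map_map hm (measurable_const_add _)]
    congr 1
    ext1 x
    simp [AddCircle.toCircle_add]
  have hVU : V = U := by
    have : V.IsHaarMeasure := Measure.isHaarMeasure_of_isCompact_nonempty_interior V Set.univ
      isCompact_univ (by simp) (by simp) (by simp)
    exact Measure.isHaarMeasure_eq_of_isProbabilityMeasure V U
  rw [← hVU, hV, Measure.map_map Circle.measurable_turn hc]
  conv_rhs => rw [← Measure.map_id (μ := volume.restrict (Set.Ico (0 : ℝ) 1))]
  refine Measure.map_congr ?_
  filter_upwards [ae_restrict_mem measurableSet_Ico] with t ht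
  simp [Circle.turn_exp, Int.fract_eq_self.2 ⟨ht.1, ht.2⟩]

end Angle

/-! ### The deletion rule and the mark: measurability and equivariance. -/

namespace SimplePointMeasure

section Kernel

variable {S : Type*} [MeasurableSpace S]

/-- A simple point measure, seen as a kernel. -/
noncomputable def kernel (S : Type*) [MeasurableSpace S] : Kernel (SimplePointMeasure S) S :=
  ⟨fun ν => ν.1, measurable_subtype_coe⟩

theorem kernel_apply (ν : SimplePointMeasure S) : kernel S ν = ν.1 := rfl

/-- Total masses are unbounded, so the kernel is cut into finite pieces by the number of points. -/
instance : IsSFiniteKernel (kernel S) := by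
  classical
  have hs : ∀ n, MeasurableSet {ν : SimplePointMeasure S | ν.count Set.univ = n} := fun n =>
    measurableSet_eq_fun (measurable_count .univ) measurable_const
  let κ : ℕ → Kernel (SimplePointMeasure S) S := fun n => Kernel.piecewise (hs n) (kernel S) 0
  have hfin : ∀ n, IsFiniteKernel (κ n) := fun n => by
    refine ⟨⟨n, ENNReal.natCast_lt_top n, fun ν => ?_⟩⟩
    rw [Kernel.piecewise_apply]
    split_ifs with h
    · rw [kernel_apply, ← ν.natCast_count .univ]
      exact_mod_cast h.le
    · simp
  have : kernel S = Kernel.sum κ := by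
    ext ν B hB
    rw [Kernel.sum_apply' _ _ hB, tsum_eq_single (ν.count Set.univ)]
    · simp [κ, Kernel.piecewise_apply]
    · intro n hn
      simp [κ, Kernel.piecewise_apply, hn.symm]
  rw [this]
  infer_instance

end Kernel

/-- `x` is removable in `ν` if, for each `j` less than the number `n` of points of `ν`, there are
at least `j` points within `j / n` turns after `x`. -/
def IsRemovable (ν : SimplePointMeasure Circle) (x : Circle) : Prop :=
  ∀ j, 1 ≤ j → j < ν.count Set.univ → j ≤ ν.count (Circle.arc x (j / ν.count Set.univ))

theorem measurableSet_isRemovable_prod :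
    MeasurableSet {p : SimplePointMeasure Circle × Circle | IsRemovable p.1 p.2} := by
  have hN : ∀ n, MeasurableSet {p : SimplePointMeasure Circle × Circle |
      p.1.count Set.univ = n} := fun n =>
    measurableSet_eq_fun ((measurable_count .univ).comp measurable_fst) measurable_const
  have harc : ∀ t : ℝ, Measurable fun p : SimplePointMeasure Circle × Circle =>
      p.1.count (Circle.arc p.2 t) := by
    intro t
    have h := Kernel.measurable_kernel_prodMk_left
      (κ := (kernel Circle).comap (Prod.fst : SimplePointMeasure Circle × Circle → _)
        measurable_fst)
      (t := {q | q.2 ∈ Circle.arc q.1.2 t})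
      ((measurable_snd.comp measurable_fst).prodMk measurable_snd
        (Circle.measurableSet_arc_prod t))
    exact Nat.measurable_floor.comp h.ennreal_toReal
  have : {p : SimplePointMeasure Circle × Circle | IsRemovable p.1 p.2} =
      ⋂ n : ℕ, ⋂ j : ℕ, ({p | p.1.count Set.univ = n}ᶜ ∪
        {p | 1 ≤ j → j < n → j ≤ p.1.count (Circle.arc p.2 (j / n))}) := by
    ext ⟨ν, x⟩
    simp only [Set.mem_ofPred_eq, Set.mem_iInter, Set.mem_union, Set.mem_compl_iff, IsRemovable]
    constructor
    · intro h n j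
      by_cases hn : ν.count Set.univ = n
      · subst hn; exact Or.inr (h j)
      · exact Or.inl hn
    · intro h j
      exact (h _ j).resolve_left (fun h => h rfl)
  rw [this]
  refine MeasurableSet.iInter fun n => MeasurableSet.iInter fun j => (hN n).compl.union ?_
  by_cases h : 1 ≤ j ∧ j < n
  · simp only [h.1, h.2, true_imp_iff]
    exact measurableSet_le measurable_const (harc _)
  · have : {p : SimplePointMeasure Circle × Circle |
        1 ≤ j → j < n → j ≤ p.1.count (Circle.arc p.2 (j / n))} = Set.univ :=
      Set.eq_univ_of_forall fun p h1 h2 => (h ⟨h1, h2⟩).elim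
    rw [this]
    exact .univ

theorem measurableSet_isRemovable (ν : SimplePointMeasure Circle) :
    MeasurableSet {x | IsRemovable ν x} :=
  measurable_prodMk_left measurableSet_isRemovable_prod

theorem _root_.IsSimplePointMeasure.restrict {S : Type*} [MeasurableSpace S] {ν : Measure S}
    (hν : IsSimplePointMeasure ν) {s : Set S} (hs : MeasurableSet s) :
    IsSimplePointMeasure (ν.restrict s) := by
  classical
  obtain ⟨A, rfl⟩ := hν
  refine ⟨A.filter (· ∈ s), ?_⟩
  ext B hB
  rw [Measure.restrict_apply hB, Measure.finsetSum_apply, Measure.finsetSum_apply,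
    Finset.sum_filter]
  refine Finset.sum_congr rfl fun x _ => ?_
  rw [Measure.dirac_apply' _ (hB.inter hs), Measure.dirac_apply' _ hB]
  by_cases h1 : x ∈ s <;> by_cases h2 : x ∈ B <;> simp [h1, h2]

/-- Remove all removable points. -/
noncomputable def thin (ν : SimplePointMeasure Circle) : SimplePointMeasure Circle :=
  ⟨ν.1.restrict {x | IsRemovable ν x}ᶜ, ν.2.restrict (measurableSet_isRemovable ν).compl⟩

theorem thin_apply (ν : SimplePointMeasure Circle) {B : Set Circle} (hB : MeasurableSet B) :
    (thin ν).1 B = ν.1 (B ∩ {x | IsRemovable ν x}ᶜ) :=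
  Measure.restrict_apply hB

theorem measurable_thin : Measurable thin := by
  refine measurable_of_eval fun B hB => ?_
  simp only [thin_apply _ hB]
  exact Kernel.measurable_kernel_prodMk_left (κ := kernel Circle)
    (t := (Prod.snd ⁻¹' B) ∩ {p | IsRemovable p.1 p.2}ᶜ)
    ((measurable_snd hB).inter measurableSet_isRemovable_prod.compl)

theorem points_thin_subset (ν : SimplePointMeasure Circle) : (thin ν).points ⊆ ν.points := by
  intro x hx
  have hx' : ν.1 ({x} ∩ {x | IsRemovable ν x}ᶜ) = 1 := by
    rw [← thin_apply ν (measurableSet_singleton x)]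
    exact hx
  by_cases h : x ∈ {x | IsRemovable ν x}ᶜ
  · rwa [Set.inter_eq_left.2 (Set.singleton_subset_iff.2 h)] at hx'
  · rw [Set.singleton_inter_eq_empty.2 h] at hx'
    simp at hx'

theorem points_iterate_thin_subset (j : ℕ) (ν : SimplePointMeasure Circle) :
    (thin^[j] ν).points ⊆ ν.points := by
  induction j with
  | zero => exact subset_rfl
  | succ j ih =>
    rw [Function.iterate_succ_apply']
    exact (points_thin_subset _).trans ih

/-- The sum of the angles from the removable points to all points. -/
noncomputable def turnSum (ν : SimplePointMeasure Circle) : ℝ :=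
  (∫⁻ x, {x | IsRemovable ν x}.indicator
    (fun x => ∫⁻ y, ENNReal.ofReal (Circle.turn (y / x)) ∂ν.1) x ∂ν.1).toReal

/-- A rotation-invariant mark. -/
noncomputable def mark (ν : SimplePointMeasure Circle) : Circle :=
  Circle.exp (2 * Real.pi * (ν.count Set.univ * turnSum ν))

theorem measurable_turnSum : Measurable turnSum := by
  have hin : Measurable fun p : SimplePointMeasure Circle × Circle =>
      ∫⁻ y, ENNReal.ofReal (Circle.turn (y / p.2)) ∂p.1.1 :=
    Measurable.lintegral_kernel_prod_right'
      (κ := (kernel Circle).comap (Prod.fst : SimplePointMeasure Circle × Circle → _)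
        measurable_fst)
      (f := fun q => ENNReal.ofReal (Circle.turn (q.2 / q.1.2)))
      (Circle.measurable_turn.comp
        (measurable_snd.div (measurable_snd.comp measurable_fst))).ennreal_ofReal
  exact (Measurable.lintegral_kernel_prod_right' (κ := kernel Circle)
    (hin.indicator measurableSet_isRemovable_prod)).ennreal_toReal

theorem measurable_mark : Measurable mark := by
  have hN : Measurable fun ν : SimplePointMeasure Circle => (ν.count Set.univ : ℝ) :=
    (Measurable.of_discrete (f := (Nat.cast : ℕ → ℝ))).comp (measurable_count .univ)
  exact Circle.exp.continuous.measurable.comp ((hN.mul measurable_turnSum).const_mul _)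

section Rotation

variable (θ : Circle) (ν : SimplePointMeasure Circle)

theorem rotate_apply {B : Set Circle} (hB : MeasurableSet B) :
    (ν.rotate θ).1 B = ν.1 ((fun x => θ * x) ⁻¹' B) :=
  Measure.map_apply (measurable_const_mul θ) hB

theorem count_rotate {B : Set Circle} (hB : MeasurableSet B) :
    (ν.rotate θ).count B = ν.count ((fun x => θ * x) ⁻¹' B) := by
  rw [count, rotate_apply θ ν hB, count]

theorem count_univ_rotate : (ν.rotate θ).count Set.univ = ν.count Set.univ :=
  count_rotate θ ν .univ

theorem isRemovable_rotate {x : Circle} :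
    IsRemovable (ν.rotate θ) (θ * x) ↔ IsRemovable ν x := by
  simp only [IsRemovable, count_univ_rotate, count_rotate _ _ (Circle.measurableSet_arc _ _)]
  have : ∀ t, (fun y => θ * y) ⁻¹' Circle.arc (θ * x) t = Circle.arc x t := fun t =>
    Set.ext fun y => Set.mem_preimage.trans (Circle.mem_arc_mul (θ := θ) (x := x) (y := y) (t := t))
  simp only [this]

theorem rotate_thin : (thin ν).rotate θ = thin (ν.rotate θ) := by
  refine Subtype.ext ?_
  ext B hB
  rw [rotate_apply _ _ hB, thin_apply _ (measurable_const_mul θ hB), thin_apply _ hB,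
    rotate_apply _ _ (hB.inter (measurableSet_isRemovable _).compl)]
  congr 1
  ext x
  simp [isRemovable_rotate]

theorem rotate_iterate_thin (j : ℕ) : (thin^[j] ν).rotate θ = thin^[j] (ν.rotate θ) := by
  induction j with
  | zero => rfl
  | succ j ih => rw [Function.iterate_succ_apply', Function.iterate_succ_apply', rotate_thin, ih]

theorem turnSum_rotate : turnSum (ν.rotate θ) = turnSum ν := by
  have h : ∀ f : Circle → ℝ≥0∞, ∫⁻ x, f x ∂(ν.rotate θ).1 = ∫⁻ x, f (θ * x) ∂ν.1 := fun f =>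
    lintegral_map_equiv f (MeasurableEquiv.mulLeft θ)
  rw [turnSum, turnSum, h]
  congr 2
  ext x
  by_cases hx : IsRemovable ν x
  · rw [Set.indicator_of_mem (show θ * x ∈ _ from (isRemovable_rotate θ ν).2 hx),
      Set.indicator_of_mem (show x ∈ _ from hx), h]
    simp only [mul_div_mul_left_eq_div]
  · rw [Set.indicator_of_notMem (show θ * x ∉ _ from fun h' => hx ((isRemovable_rotate θ ν).1 h')),
      Set.indicator_of_notMem (show x ∉ _ from hx)]

theorem mark_rotate : mark (ν.rotate θ) = mark ν := by
  rw [mark, mark, turnSum_rotate, count_univ_rotate]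

end Rotation

end SimplePointMeasure

/-! ### Combinatorics of removable points. -/

namespace SimplePointMeasure

open Classical in
theorem count_ofFn {S : Type*} [MeasurableSpace S] {n : ℕ} {x : Fin n → S}
    (hx : Function.Injective x) {B : Set S} (hB : MeasurableSet B) :
    (ofFn x).count B = (Finset.univ.filter fun l => x l ∈ B).card := by
  rw [count_eq_iff _ hB, ofFn_apply hx]
  simp [Measure.finsetSum_apply, Measure.dirac_apply' _ hB, Set.indicator_apply]

theorem lintegral_ofFn {S : Type*} [MeasurableSpace S] [MeasurableSingletonClass S] {n : ℕ}
    {x : Fin n → S} (hx : Function.Injective x) (f : S → ℝ≥0∞) :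
    ∫⁻ y, f y ∂(ofFn x).1 = ∑ l, f (x l) := by
  rw [ofFn_apply hx, lintegral_finsetSum_measure]
  simp

open Classical in
/-- The points whose addition to `A 0, …, A (k - 1)` gives a removable point. -/
def removableSet {k : ℕ} (A : Fin k → Circle) : Set Circle :=
  {z | ∀ j, 1 ≤ j → j < k + 1 →
    j ≤ (Finset.univ.filter fun l => A l ∈ Circle.arc z (j / ((k + 1 : ℕ) : ℝ))).card}

theorem isRemovable_ofFn {k : ℕ} {x : Fin (k + 1) → Circle} (hx : Function.Injective x)
    (i : Fin (k + 1)) : IsRemovable (ofFn x) (x i) ↔ x i ∈ removableSet (i.removeNth x) := by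
  classical
  have h : ∀ t, (ofFn x).count (Circle.arc (x i) t) =
      (Finset.univ.filter fun l => i.removeNth x l ∈ Circle.arc (x i) t).card := by
    intro t
    rw [count_ofFn hx (Circle.measurableSet_arc _ _), Finset.card_filter, Finset.card_filter,
      Fin.sum_univ_succAbove _ i]
    simp only [Circle.notMem_arc_self, if_false, zero_add, Fin.removeNth]
    exact Finset.sum_congr rfl fun l _ => by congr
  simp only [IsRemovable, removableSet, count_univ_ofFn hx, h]
  rfl

/-- Take the point with the least total turn to all points. If the arc of j / (k + 1) turns after it
held fewer than j points, restarting from the first point beyond that arc would lower the total. -/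
theorem exists_isRemovable_ofFn {k : ℕ} {x : Fin (k + 1) → Circle} (hx : Function.Injective x) :
    ∃ i, IsRemovable (ofFn x) (x i) := by
  classical
  obtain ⟨i, hi⟩ := Finite.exists_min fun i => ∑ l, Circle.turn (x l / x i)
  refine ⟨i, fun j hj hjn => ?_⟩
  rw [count_univ_ofFn hx] at hjn ⊢
  rw [count_ofFn hx (Circle.measurableSet_arc _ _)]
  by_contra! hlt
  set G := Finset.univ.filter fun l => x l ∈ Circle.arc (x i) (j / ((k + 1 : ℕ) : ℝ)) with hG
  have hGi : (insert i G).card ≤ j := (Finset.card_insert_le _ _).trans hlt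
  have hne : (insert i G)ᶜ.Nonempty := by
    rw [← Finset.card_pos, Finset.card_compl, Fintype.card_fin]
    omega
  obtain ⟨m, hm, hmin⟩ := Finset.exists_min_image _ (fun l => Circle.turn (x l / x i)) hne
  rw [Finset.mem_compl, Finset.mem_insert, not_or, hG, Finset.mem_filter] at hm
  set d := Circle.turn (x m / x i) with hd
  have hd0 : 0 < d := by
    refine lt_of_le_of_ne (Circle.turn_nonneg _) fun h0 => hm.1 (hx ?_)
    exact div_eq_one.1 (Circle.turn_eq_zero.1 h0.symm)
  have hdj : (j : ℝ) < (k + 1 : ℕ) * d := by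
    by_contra! hle
    refine hm.2 ⟨Finset.mem_univ _, hd0, ?_⟩
    rw [le_div_iff₀ (by positivity), mul_comm]
    exact hle
  -- Moving the base by d lowers every turn by d, except that the points passed over gain a full
  -- turn. There are at most j of these, the old base included.
  have hsum : ∑ l, Circle.turn (x l / x m) = ∑ l, Circle.turn (x l / x i) - (k + 1 : ℕ) * d +
      (Finset.univ.filter fun l => Circle.turn (x l / x i) < d).card := by
    rw [Finset.card_filter]
    push_cast
    have : ∀ l, Circle.turn (x l / x m) = Circle.turn (x l / x i) - d +
        if Circle.turn (x l / x i) < d then 1 else 0 := fun l => by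
      rw [← Circle.turn_div, div_div_div_cancel_right]
    simp only [this, Finset.sum_add_distrib, Finset.sum_sub_distrib]
    simp
  have hcard : (Finset.univ.filter fun l => Circle.turn (x l / x i) < d).card ≤ j := by
    refine (Finset.card_le_card fun l hl => ?_).trans hGi
    by_contra hl'
    exact absurd (hmin l (Finset.mem_compl.2 hl')) (not_le.2 (Finset.mem_filter.1 hl).2)
  have hcard' : ((Finset.univ.filter fun l => Circle.turn (x l / x i) < d).card : ℝ) ≤ j := by
    exact_mod_cast hcard
  have := hi m
  linarith

/-- The rotation by `i / n` turns. -/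
noncomputable def root (n i : ℕ) : Circle := Circle.exp (2 * Real.pi * (i / n))

theorem root_pow (n i : ℕ) (hn : n ≠ 0) : root n i ^ n = 1 := by
  rw [root, ← Circle.exp_nsmul, nsmul_eq_mul]
  have : (n : ℝ) * (2 * Real.pi * (i / n)) = 2 * Real.pi * (i : ℤ) := by
    push_cast
    field_simp
  rw [this, Circle.exp_two_pi_mul_int]

theorem turn_root {n i : ℕ} (hi : i < n) : Circle.turn (root n i) = i / n := by
  have hn : (0 : ℝ) < n := by exact_mod_cast (Nat.zero_le i).trans_lt hi
  rw [root, Circle.turn_exp, Int.fract_eq_self]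
  refine ⟨by positivity, ?_⟩
  rw [div_lt_one hn]
  exact_mod_cast hi

theorem root_add (n i j : ℕ) : root n (i + j) = root n i * root n j := by
  rw [root, root, root, ← Circle.exp_add]
  push_cast
  ring_nf

/-- Otherwise the arc of i / (k + 1) turns after z and the complementary arc after the rotated
point, which are disjoint, would hold at least k + 1 of the k points. -/
theorem root_mul_notMem_removableSet {k : ℕ} {A : Fin k → Circle} {z : Circle}
    (hz : z ∈ removableSet A) {i : ℕ} (hi : 1 ≤ i) (hik : i < k + 1) :
    root (k + 1) i * z ∉ removableSet A := by
  classical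
  intro hz'
  have h1 := hz i hi hik
  have h2 := hz' (k + 1 - i) (by omega) (by omega)
  have hdisj : Disjoint
      (Finset.univ.filter fun l => A l ∈ Circle.arc z (i / ((k + 1 : ℕ) : ℝ)))
      (Finset.univ.filter fun l => A l ∈ Circle.arc (root (k + 1) i * z)
        ((k + 1 - i : ℕ) / ((k + 1 : ℕ) : ℝ))) := by
    rw [Finset.disjoint_filter]
    rintro l - ⟨hl1, hl2⟩ ⟨hl3, hl4⟩
    have e : A l / (root (k + 1) i * z) = (A l / z) / root (k + 1) i := by
      rw [mul_comm, div_mul_eq_div_div]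
    rw [e, Circle.turn_div, turn_root hik] at hl3 hl4
    have e2 : ((k + 1 - i : ℕ) : ℝ) / ((k + 1 : ℕ) : ℝ) = 1 - i / ((k + 1 : ℕ) : ℝ) := by
      rw [Nat.cast_sub hik.le, sub_div, div_self (by positivity)]
    rw [e2] at hl4
    split_ifs at hl3 hl4 <;> linarith
  have h3 := Finset.card_union_of_disjoint hdisj
  have h4 := Finset.card_le_univ ((Finset.univ.filter fun l =>
    A l ∈ Circle.arc z (i / ((k + 1 : ℕ) : ℝ))) ∪
      (Finset.univ.filter fun l => A l ∈ Circle.arc (root (k + 1) i * z)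
        ((k + 1 - i : ℕ) / ((k + 1 : ℕ) : ℝ))))
  rw [Fintype.card_fin] at h4
  omega

theorem thin_ofFn {k : ℕ} {x : Fin (k + 1) → Circle} (hx : Function.Injective x)
    {i : Fin (k + 1)} (hi : ∀ l, IsRemovable (ofFn x) (x l) ↔ l = i) :
    thin (ofFn x) = ofFn (i.removeNth x) := by
  classical
  have hx' : Function.Injective (i.removeNth x) := hx.comp Fin.succAbove_right_injective
  refine Subtype.ext ?_
  ext B hB
  rw [thin_apply _ hB, ofFn_apply hx, ofFn_apply hx', Measure.finsetSum_apply,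
    Measure.finsetSum_apply, Fin.sum_univ_succAbove _ i]
  have hm := (hB.inter (measurableSet_isRemovable (ofFn x)).compl)
  simp only [Measure.dirac_apply' _ hm, Measure.dirac_apply' _ hB]
  rw [Set.indicator_of_notMem (fun h => h.2 ((hi i).2 rfl)), zero_add]
  refine Finset.sum_congr rfl fun l _ => ?_
  have hl : ¬ IsRemovable (ofFn x) (x (i.succAbove l)) := fun h =>
    Fin.succAbove_ne i l ((hi _).1 h)
  by_cases hb : x (i.succAbove l) ∈ B
  · rw [Set.indicator_of_mem
      (show x (i.succAbove l) ∈ B ∩ {z | IsRemovable (ofFn x) z}ᶜ from ⟨hb, hl⟩), Set.indicator_of_mem (show i.removeNth x l ∈ B from hb)]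
    rfl
  · rw [Set.indicator_of_notMem (fun h => hb h.1),
      Set.indicator_of_notMem (show i.removeNth x l ∉ B from hb)]

/-- Exponentiating turns the sum of angles into a product of quotients; the deleted point itself
contributes 1. -/
theorem mark_ofFn {k : ℕ} {x : Fin (k + 1) → Circle} (hx : Function.Injective x)
    {i : Fin (k + 1)} (hi : ∀ l, IsRemovable (ofFn x) (x l) ↔ l = i) :
    mark (ofFn x) = (∏ l, i.removeNth x l / x i) ^ (k + 1) := by
  classical
  have hs : turnSum (ofFn x) = ∑ l, Circle.turn (x l / x i) := by
    rw [turnSum, lintegral_ofFn hx, Finset.sum_eq_single i, Set.indicator_of_mem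
      (show x i ∈ _ from (hi i).2 rfl), lintegral_ofFn hx,
      ← ENNReal.ofReal_sum_of_nonneg fun l _ => Circle.turn_nonneg _, ENNReal.toReal_ofReal]
    · exact Finset.sum_nonneg fun l _ => Circle.turn_nonneg _
    · intro l _ hl
      exact Set.indicator_of_notMem (fun h => hl ((hi l).1 h)) _
    · simp
  rw [mark, hs, count_univ_ofFn hx, mul_left_comm, ← nsmul_eq_mul, Circle.exp_nsmul,
    Finset.mul_sum, Fin.sum_univ_succAbove _ i, Circle.exp_add, Circle.exp_two_pi_mul_turn,
    div_self', one_mul]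
  congr 1
  have : ∀ s : Finset (Fin k), Circle.exp (∑ l ∈ s,
      2 * Real.pi * Circle.turn (x (i.succAbove l) / x i)) = ∏ l ∈ s, i.removeNth x l / x i := by
    intro s
    induction s using Finset.induction_on with
    | empty => simp
    | insert a s ha ih =>
      rw [Finset.sum_insert ha, Finset.prod_insert ha, Circle.exp_add, ih,
        Circle.exp_two_pi_mul_turn]
      rfl
  exact this _

end SimplePointMeasure

/-! ### Joint law of the survivors and the mark. -/

namespace SimplePointMeasure

variable {k : ℕ}

theorem measurableSet_removableSet_prod :
    MeasurableSet {p : Circle × (Fin k → Circle) | p.1 ∈ removableSet p.2} := by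
  classical
  have hcard : ∀ t : ℝ, Measurable fun p : Circle × (Fin k → Circle) =>
      (Finset.univ.filter fun l => p.2 l ∈ Circle.arc p.1 t).card := by
    intro t
    simp only [Finset.card_filter]
    refine Finset.measurable_fun_sum _ fun l _ => Measurable.ite ?_ measurable_const
      measurable_const
    have h : Measurable fun p : Circle × (Fin k → Circle) => (p.1, p.2 l) :=
      measurable_fst.prodMk ((measurable_pi_apply l).comp measurable_snd)
    exact h (Circle.measurableSet_arc_prod t)
  have : {p : Circle × (Fin k → Circle) | p.1 ∈ removableSet p.2} =
      ⋂ (j : ℕ) (_ : 1 ≤ j) (_ : j < k + 1), {p | j ≤ (Finset.univ.filter fun l =>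
        p.2 l ∈ Circle.arc p.1 (j / ((k + 1 : ℕ) : ℝ))).card} := by
    ext p
    simp [removableSet]
  rw [this]
  exact MeasurableSet.iInter fun j => MeasurableSet.iInter fun _ => MeasurableSet.iInter fun _ =>
    measurableSet_le measurable_const (hcard _)

/-- The indicator function of the removable set. -/
noncomputable def removableInd (z : Circle) (A : Fin k → Circle) : ℝ≥0∞ :=
  (removableSet A).indicator 1 z

theorem measurable_removableInd :
    Measurable fun p : Circle × (Fin k → Circle) => removableInd p.1 p.2 :=
  (measurable_one (α := ℝ≥0∞)).indicator measurableSet_removableSet_prod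

theorem removableInd_of_mem {z : Circle} {A : Fin k → Circle} (h : z ∈ removableSet A) :
    removableInd z A = 1 := Set.indicator_of_mem h _

theorem removableInd_of_notMem {z : Circle} {A : Fin k → Circle} (h : z ∉ removableSet A) :
    removableInd z A = 0 := Set.indicator_of_notMem h _

theorem sum_removableInd_le_one (z : Circle) (A : Fin k → Circle) :
    ∑ i ∈ Finset.range (k + 1), removableInd (root (k + 1) i * z) A ≤ 1 := by
  classical
  by_cases h : ∃ i ∈ Finset.range (k + 1), root (k + 1) i * z ∈ removableSet A ∧
      ∀ j < i, root (k + 1) j * z ∉ removableSet A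
  · obtain ⟨i, hi, hiz, hmin⟩ := h
    rw [Finset.sum_eq_single_of_mem i hi]
    · exact (removableInd_of_mem hiz).le
    · intro j hj hji
      refine removableInd_of_notMem ?_
      rcases lt_or_gt_of_ne hji with hlt | hlt
      · exact hmin j hlt
      · have := root_mul_notMem_removableSet hiz (i := j - i) (by omega)
          (by have := Finset.mem_range.1 hj; omega)
        rwa [← mul_assoc, ← root_add, Nat.sub_add_cancel hlt.le] at this
  · rw [Finset.sum_eq_zero]
    · exact zero_le_one
    · intro i hi
      refine removableInd_of_notMem fun hiz => h ?_
      have hex : ∃ i, root (k + 1) i * z ∈ removableSet A := ⟨i, hiz⟩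
      refine ⟨Nat.find hex, ?_, Nat.find_spec hex, fun j hj => Nat.find_min hex hj⟩
      exact Finset.mem_range.2 ((Nat.find_min' hex hiz).trans_lt (Finset.mem_range.1 hi))

variable (U : Measure Circle) [U.IsHaarMeasure]

theorem lintegral_removeNth (i : Fin (k + 1)) {G : Circle → (Fin k → Circle) → ℝ≥0∞}
    (hG : Measurable fun p : Circle × (Fin k → Circle) => G p.1 p.2) :
    ∫⁻ x, G (x i) (i.removeNth x) ∂Measure.pi (fun _ : Fin (k + 1) => U) =
      ∫⁻ A, ∫⁻ z, G z A ∂U ∂Measure.pi (fun _ : Fin k => U) := by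
  have h := (measurePreserving_piFinSuccAbove (fun _ : Fin (k + 1) => U) i).lintegral_comp hG
  rw [lintegral_prod_symm' _ hG] at h
  exact h

/-- Singling out any coordinate gives the same integral, so the left side is k + 1 copies of it.
Invariance of `U` and `G` distributes these copies over the rotations by roots of unity. -/
theorem lintegral_removableInd_mul {G : Circle → (Fin k → Circle) → ℝ≥0∞}
    (hG : Measurable fun p : Circle × (Fin k → Circle) => G p.1 p.2)
    (hinv : ∀ i z A, G (root (k + 1) i * z) A = G z A) :
    ∑ i : Fin (k + 1), ∫⁻ x, removableInd (x i) (i.removeNth x) * G (x i) (i.removeNth x)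
        ∂Measure.pi (fun _ : Fin (k + 1) => U) =
      ∫⁻ A, ∫⁻ z, (∑ i ∈ Finset.range (k + 1), removableInd (root (k + 1) i * z) A) * G z A ∂U
        ∂Measure.pi (fun _ : Fin k => U) := by
  have hm : Measurable fun p : Circle × (Fin k → Circle) => removableInd p.1 p.2 * G p.1 p.2 :=
    measurable_removableInd.mul hG
  have h1 : ∀ i : Fin (k + 1), ∫⁻ x, removableInd (x i) (i.removeNth x) *
      G (x i) (i.removeNth x) ∂Measure.pi (fun _ : Fin (k + 1) => U) =
      ∫⁻ A, ∫⁻ z, removableInd z A * G z A ∂U ∂Measure.pi (fun _ : Fin k => U) := fun i =>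
    lintegral_removeNth U i (G := fun z A => removableInd z A * G z A) hm
  have h2 : ∀ A : Fin k → Circle, ∫⁻ z, (∑ i ∈ Finset.range (k + 1),
      removableInd (root (k + 1) i * z) A) * G z A ∂U =
      (k + 1 : ℕ) * ∫⁻ z, removableInd z A * G z A ∂U := by
    intro A
    have hmA : Measurable fun z => removableInd z A * G z A := by
      have h := hm.comp (measurable_id.prodMk (measurable_const (a := A)))
      exact h
    have hmA' : ∀ i, Measurable fun z =>
        removableInd (root (k + 1) i * z) A * G (root (k + 1) i * z) A := fun i => by
      have h := hmA.comp (measurable_const_mul (root (k + 1) i))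
      exact h
    simp only [Finset.sum_mul]
    have h3 : ∀ i z, removableInd (root (k + 1) i * z) A * G z A =
        removableInd (root (k + 1) i * z) A * G (root (k + 1) i * z) A := fun i z => by
      rw [hinv]
    simp only [h3]
    rw [lintegral_finsetSum _ fun i _ => hmA' i]
    have h4 : ∀ i, ∫⁻ z, removableInd (root (k + 1) i * z) A * G (root (k + 1) i * z) A ∂U =
        ∫⁻ z, removableInd z A * G z A ∂U := fun i =>
      lintegral_mul_left_eq_self (μ := U) (fun z => removableInd z A * G z A) (root (k + 1) i)
    simp only [h4]
    simp
  simp only [h1, h2]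
  rw [lintegral_const_mul _ hm.lintegral_prod_left']
  simp

variable [IsProbabilityMeasure U]

theorem one_le_sum_removableInd {x : Fin (k + 1) → Circle} (hx : Function.Injective x) :
    1 ≤ ∑ i : Fin (k + 1), removableInd (x i) (i.removeNth x) := by
  obtain ⟨i, hi⟩ := exists_isRemovable_ofFn hx
  rw [isRemovable_ofFn hx] at hi
  rw [← removableInd_of_mem hi]
  exact Finset.single_le_sum (f := fun i : Fin (k + 1) => removableInd (x i) (i.removeNth x))
    (fun _ _ => zero_le) (Finset.mem_univ i)

theorem measurable_prodMk_removeNth (i : Fin (k + 1)) :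
    Measurable fun x : Fin (k + 1) → Circle => (x i, i.removeNth x) :=
  (measurable_pi_apply i).prodMk
    (measurable_pi_lambda _ fun l => measurable_pi_apply (i.succAbove l))

theorem measurable_removableInd_removeNth (i : Fin (k + 1)) :
    Measurable fun x : Fin (k + 1) → Circle => removableInd (x i) (i.removeNth x) := by
  have h := measurable_removableInd.comp (measurable_prodMk_removeNth (k := k) i)
  exact h

theorem measurable_sum_removableInd : Measurable fun p : (Fin k → Circle) × Circle =>
    ∑ i ∈ Finset.range (k + 1), removableInd (root (k + 1) i * p.2) p.1 := by
  refine Finset.measurable_fun_sum _ fun i _ => ?_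
  have h : Measurable fun p : (Fin k → Circle) × Circle => (root (k + 1) i * p.2, p.1) :=
    (measurable_snd.const_mul _).prodMk measurable_fst
  have h' := measurable_removableInd.comp h
  exact h'

/-- The first integrand is almost everywhere at least 1, the second at most 1, and the integrals
coincide. Equality then forces uniqueness of the removable point and the tiling of the circle by
translates of the removable set. -/
theorem lintegral_sum_removableInd :
    ∫⁻ x, ∑ i : Fin (k + 1), removableInd (x i) (i.removeNth x)
      ∂Measure.pi (fun _ : Fin (k + 1) => U) = 1 ∧
    ∫⁻ A, ∫⁻ z, ∑ i ∈ Finset.range (k + 1), removableInd (root (k + 1) i * z) A ∂U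
        ∂Measure.pi (fun _ : Fin k => U) = 1 := by
  have h := lintegral_removableInd_mul U (k := k) (G := fun _ _ => 1) measurable_const
    fun _ _ _ => rfl
  simp only [mul_one] at h
  rw [← lintegral_finsetSum _ fun i _ => measurable_removableInd_removeNth i] at h
  have hge : 1 ≤ ∫⁻ x, ∑ i : Fin (k + 1), removableInd (x i) (i.removeNth x)
      ∂Measure.pi (fun _ : Fin (k + 1) => U) := by
    calc (1 : ℝ≥0∞) = ∫⁻ _, 1 ∂Measure.pi (fun _ : Fin (k + 1) => U) := by simp
      _ ≤ _ := lintegral_mono_ae (by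
        filter_upwards [ae_injective_pi U (k + 1)] with x hx using one_le_sum_removableInd hx)
  have hle : ∫⁻ A, ∫⁻ z, ∑ i ∈ Finset.range (k + 1), removableInd (root (k + 1) i * z) A ∂U
        ∂Measure.pi (fun _ : Fin k => U) ≤ 1 := by
    calc _ ≤ ∫⁻ _, ∫⁻ _, 1 ∂U ∂Measure.pi (fun _ : Fin k => U) :=
          lintegral_mono fun A => lintegral_mono fun z => sum_removableInd_le_one z A
      _ = 1 := by simp
  exact ⟨le_antisymm (h.trans_le hle) hge, le_antisymm hle (hge.trans_eq h)⟩

theorem ae_sum_removableInd_removeNth : ∀ᵐ x ∂Measure.pi (fun _ : Fin (k + 1) => U),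
    ∑ i : Fin (k + 1), removableInd (x i) (i.removeNth x) = 1 := by
  have h := ae_eq_of_ae_le_of_lintegral_le (μ := Measure.pi (fun _ : Fin (k + 1) => U))
    (f := fun _ => (1 : ℝ≥0∞))
    (g := fun x => ∑ i : Fin (k + 1), removableInd (x i) (i.removeNth x))
    (by filter_upwards [ae_injective_pi U (k + 1)] with x hx using one_le_sum_removableInd hx)
    (by simp)
    (Finset.measurable_fun_sum _ fun i _ => measurable_removableInd_removeNth i).aemeasurable
    (by simpa using (lintegral_sum_removableInd U).1.le)
  filter_upwards [h] with x hx using hx.symm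

theorem ae_sum_removableInd : ∀ᵐ A ∂Measure.pi (fun _ : Fin k => U), ∀ᵐ z ∂U,
    ∑ i ∈ Finset.range (k + 1), removableInd (root (k + 1) i * z) A = 1 := by
  refine Measure.ae_ae_of_ae_prod (p := fun p : (Fin k → Circle) × Circle =>
    ∑ i ∈ Finset.range (k + 1), removableInd (root (k + 1) i * p.2) p.1 = 1) ?_
  have hI := (lintegral_sum_removableInd U (k := k)).2
  rw [← lintegral_prod (fun p : (Fin k → Circle) × Circle => ∑ i ∈ Finset.range (k + 1),
    removableInd (root (k + 1) i * p.2) p.1) measurable_sum_removableInd.aemeasurable] at hI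
  exact ae_eq_of_ae_le_of_lintegral_le (g := fun _ => (1 : ℝ≥0∞))
    (Filter.Eventually.of_forall fun p => sum_removableInd_le_one p.2 p.1)
    (by rw [hI]; exact ENNReal.one_ne_top) aemeasurable_const (by rw [hI]; simp)

theorem existsUnique_of_sum_removableInd {x : Fin (k + 1) → Circle} (hx : Function.Injective x)
    (h : ∑ i : Fin (k + 1), removableInd (x i) (i.removeNth x) = 1) :
    ∃ i, ∀ l, IsRemovable (ofFn x) (x l) ↔ l = i := by
  obtain ⟨i, hi⟩ := exists_isRemovable_ofFn hx
  refine ⟨i, fun l => ⟨fun hl => ?_, fun hl => hl ▸ hi⟩⟩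
  by_contra hne
  rw [isRemovable_ofFn hx] at hi hl
  have : ∑ j ∈ {l, i}, removableInd (x j) (j.removeNth x) ≤ 1 := by
    rw [← h]
    exact Finset.sum_le_sum_of_subset (Finset.subset_univ _)
  rw [Finset.sum_pair hne, removableInd_of_mem hi, removableInd_of_mem hl] at this
  norm_num at this

/-- The mark sees the deleted point z only through its power k (k + 1), which is blind to (k + 1)-th
roots of unity. As the translates of the removable set tile the circle, z may range over the whole
circle. -/
theorem lintegral_thin_mark {Φ : SimplePointMeasure Circle × Circle → ℝ≥0∞} (hΦ : Measurable Φ) :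
    ∫⁻ ν, Φ (thin ν, mark ν) ∂binomialLaw U (k + 1) =
      ∫⁻ A, ∫⁻ z, Φ (ofFn A, (∏ l, A l) ^ (k + 1) / z ^ (k * (k + 1))) ∂U
        ∂Measure.pi (fun _ : Fin k => U) := by
  let G : Circle → (Fin k → Circle) → ℝ≥0∞ := fun z A =>
    Φ (ofFn A, (∏ l, A l) ^ (k + 1) / z ^ (k * (k + 1)))
  have hG : Measurable fun p : Circle × (Fin k → Circle) => G p.1 p.2 := by
    refine hΦ.comp (((measurable_ofFn k).comp measurable_snd).prodMk ?_)
    refine Measurable.div (Measurable.pow_const ?_ _) (measurable_fst.pow_const _)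
    exact Finset.measurable_fun_prod _ fun l _ => (measurable_pi_apply l).comp measurable_snd
  have hinv : ∀ i z A, G (root (k + 1) i * z) A = G z A := fun i z A => by
    simp only [G]
    rw [mul_pow, mul_comm k, pow_mul, root_pow _ _ (Nat.succ_ne_zero k), one_pow, one_mul]
  have hmG : ∀ i : Fin (k + 1), Measurable fun x : Fin (k + 1) → Circle =>
      removableInd (x i) (i.removeNth x) * G (x i) (i.removeNth x) := fun i => by
    have h := hG.comp (measurable_prodMk_removeNth i)
    exact (measurable_removableInd_removeNth i).mul h
  have hΦ' : Measurable fun ν => Φ (thin ν, mark ν) :=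
    hΦ.comp (measurable_thin.prodMk measurable_mark)
  rw [binomialLaw, lintegral_map hΦ' (measurable_ofFn _)]
  calc _ = ∫⁻ x, ∑ i : Fin (k + 1), removableInd (x i) (i.removeNth x) *
        G (x i) (i.removeNth x) ∂Measure.pi (fun _ : Fin (k + 1) => U) := by
        refine lintegral_congr_ae ?_
        filter_upwards [ae_injective_pi U (k + 1), ae_sum_removableInd_removeNth U] with x hx hx1
        obtain ⟨i, hi⟩ := existsUnique_of_sum_removableInd hx hx1
        rw [thin_ofFn hx hi, mark_ofFn hx hi, Finset.sum_eq_single i, removableInd_of_mem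
          ((isRemovable_ofFn hx i).1 ((hi i).2 rfl)), one_mul]
        · simp only [G]
          rw [Finset.prod_div_distrib, div_pow]
          simp [pow_mul]
        · intro l _ hl
          rw [removableInd_of_notMem fun h => hl ((hi l).1 ((isRemovable_ofFn hx l).2 h)), zero_mul]
        · simp
    _ = _ := by
        rw [lintegral_finsetSum _ fun i _ => hmG i, lintegral_removableInd_mul U hG hinv]
        refine lintegral_congr_ae ?_
        filter_upwards [ae_sum_removableInd U] with A hA
        refine lintegral_congr_ae ?_
        filter_upwards [hA] with z hz
        rw [hz, one_mul]

theorem map_thin_binomialLaw :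
    (binomialLaw U (k + 1)).map thin = binomialLaw U k := by
  ext s hs
  have hm : Measurable (s.indicator (1 : SimplePointMeasure Circle → ℝ≥0∞)) :=
    measurable_one.indicator hs
  rw [← lintegral_indicator_one hs, ← lintegral_indicator_one hs, lintegral_map hm measurable_thin,
    lintegral_thin_mark U (Φ := fun p => s.indicator 1 p.1) (hm.comp measurable_fst),
    binomialLaw, lintegral_map hm (measurable_ofFn k)]
  simp

theorem map_iterate_thin_binomialLaw (j : ℕ) :
    (binomialLaw U (k + j)).map thin^[j] = binomialLaw U k := by
  induction j with
  | zero => exact Measure.map_id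
  | succ j ih =>
    rw [Function.iterate_succ, ← Measure.map_map (measurable_thin.iterate j) measurable_thin,
      ← add_assoc, map_thin_binomialLaw, ih]

/-- For fixed survivors the mark is a constant divided by a nontrivial power of a uniform point,
hence uniform. For k = 0 the exponent vanishes and the mark is constant. -/
theorem map_thin_mark_binomialLaw (hk : k ≠ 0) :
    (binomialLaw U (k + 1)).map (fun ν => (thin ν, mark ν)) =
      (binomialLaw U k).prod U := by
  ext s hs
  have hm : Measurable (s.indicator (1 : SimplePointMeasure Circle × Circle → ℝ≥0∞)) :=
    measurable_one.indicator hs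
  rw [← lintegral_indicator_one hs, ← lintegral_indicator_one hs,
    lintegral_map hm (measurable_thin.prodMk measurable_mark), lintegral_thin_mark U hm,
    lintegral_prod _ hm.aemeasurable, binomialLaw,
    lintegral_map hm.lintegral_prod_right' (measurable_ofFn k)]
  refine lintegral_congr fun A => ?_
  exact (measurePreserving_div_pow U _ (mul_ne_zero hk (Nat.succ_ne_zero k))).lintegral_comp
    (hm.comp (measurable_const.prodMk measurable_id))

end SimplePointMeasure

/-! ### Quantile coupling of the numbers of points. -/

section Quantile

variable (a b : ℝ≥0) (k : ℕ)

/-- The cumulative weights left to the second Poisson law once the values at most `k` of the first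
one are kept fixed. -/
noncomputable def residualCdf (m : ℕ) : ℝ :=
  poissonCdf b m + (poissonCdf a (k + 1) - poissonCdf a (min m (k + 1)))

theorem residualCdf_zero : residualCdf a b k 0 = poissonCdf a (k + 1) := by
  simp [residualCdf, poissonCdf]

theorem residualCdf_of_lt {m : ℕ} (h : k < m) : residualCdf a b k m = poissonCdf b m := by
  rw [residualCdf, min_eq_right (by omega), sub_self, add_zero]

theorem residualCdf_succ (m : ℕ) : residualCdf a b k (m + 1) =
    residualCdf a b k m + (poissonProb b m - if m ≤ k then poissonProb a m else 0) := by
  split_ifs with h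
  · rw [residualCdf, residualCdf, min_eq_left (by omega), min_eq_left (by omega),
      poissonCdf_succ b m, poissonCdf_succ a m]
    ring
  · rw [residualCdf_of_lt _ _ _ (by omega), residualCdf_of_lt _ _ _ (by omega), poissonCdf_succ]
    ring

theorem tendsto_residualCdf :
    Filter.Tendsto (residualCdf a b k) Filter.atTop (nhds 1) := by
  refine (tendsto_poissonCdf b).congr' ?_
  filter_upwards [Filter.eventually_gt_atTop k] with m hm
  rw [residualCdf_of_lt _ _ _ hm]

variable {a b k}

theorem residualCdf_mono (h : ∀ m ≤ k, poissonProb a m ≤ poissonProb b m) :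
    Monotone (residualCdf a b k) := by
  refine monotone_nat_of_le_succ fun m => ?_
  rw [residualCdf_succ]
  split_ifs with hm
  · linarith [h m hm]
  · linarith [poissonProb_nonneg b m]

/-- The second alternative only makes the quantile total, with value 0 for v ≥ 1; the coupling uses
v < 1. -/
theorem exists_lt_residualCdf (a b : ℝ≥0) (k : ℕ) (v : ℝ) :
    ∃ m, v < residualCdf a b k (m + 1) ∨ 1 ≤ v := by
  rcases le_or_gt 1 v with hv | hv
  · exact ⟨0, Or.inr hv⟩
  · obtain ⟨m, hm⟩ := (((tendsto_residualCdf a b k).comp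
      (Filter.tendsto_add_atTop_nat 1)).eventually (lt_mem_nhds hv)).exists
    exact ⟨m, Or.inl hm⟩

open Classical in
/-- The quantile function of the residual weights. -/
noncomputable def residualQuantile (a b : ℝ≥0) (k : ℕ) (v : ℝ) : ℕ :=
  Nat.find (exists_lt_residualCdf a b k v)

theorem measurable_residualQuantile : Measurable (residualQuantile a b k) := by
  classical
  exact measurable_find _ fun m => measurableSet_Iio.union measurableSet_Ici

theorem residualQuantile_eq_iff (h : ∀ m ≤ k, poissonProb a m ≤ poissonProb b m) {v : ℝ}
    (h0 : poissonCdf a (k + 1) ≤ v) (h1 : v < 1) {m : ℕ} :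
    residualQuantile a b k v = m ↔
      v ∈ Set.Ico (residualCdf a b k m) (residualCdf a b k (m + 1)) := by
  classical
  rw [residualQuantile, Nat.find_eq_iff]
  constructor
  · rintro ⟨hm, hlt⟩
    refine ⟨?_, hm.resolve_right (not_le.2 h1)⟩
    cases m with
    | zero => rwa [residualCdf_zero]
    | succ m => exact not_lt.1 fun hv => hlt m (Nat.lt_succ_self m) (Or.inl hv)
  · rintro ⟨hm, hm'⟩
    refine ⟨Or.inl hm', fun n hn hn' => ?_⟩
    have := hn'.resolve_right (not_le.2 h1)
    linarith [residualCdf_mono h (show n + 1 ≤ m from hn)]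

/-- The number of points to keep out of `n`, given a uniform variable `t`. -/
noncomputable def keepCount (a b : ℝ≥0) (k n : ℕ) (t : ℝ) : ℕ :=
  residualQuantile a b k (poissonCdf a n + poissonProb a n * t)

theorem measurable_keepCount (n : ℕ) : Measurable (keepCount a b k n) :=
  measurable_residualQuantile.comp ((measurable_id.const_mul _).const_add _)

theorem poissonCdf_add_mem_Ico (ha : 0 < a) (n : ℕ) {t : ℝ} (ht : t ∈ Set.Ico 0 1) :
    poissonCdf a n + poissonProb a n * t ∈ Set.Ico (poissonCdf a n) (poissonCdf a (n + 1)) := by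
  have hp := poissonProb_pos ha n
  rw [poissonCdf_succ]
  constructor
  · have := mul_nonneg hp.le ht.1
    linarith
  · have := mul_lt_mul_of_pos_left ht.2 hp
    linarith

/-- P(X ≤ n) ≤ P(Y ≤ n - 1) puts the whole interval of n below the level at which the quantile
reaches n. Strictness is needed since the mark is independent only of what remains after one
deletion. -/
theorem keepCount_lt (hb : 0 < b) (hab : b < a)
    (hcdf : poissonCdf a (k + 2) ≤ poissonCdf b (k + 1)) {n : ℕ} (hn : k < n) {t : ℝ}
    (ht : t ∈ Set.Ico 0 1) : keepCount a b k n t < n := by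
  classical
  obtain ⟨n, rfl⟩ := Nat.exists_eq_succ_of_ne_zero (Nat.ne_zero_of_lt hn)
  rw [Nat.lt_succ_iff]
  refine Nat.find_min' _ (Or.inl ?_)
  rw [residualCdf_of_lt _ _ _ hn]
  exact (poissonCdf_add_mem_Ico (hb.trans hab) _ ht).2.trans_le
    (poissonCdf_succ_le_of_le hb hab hcdf hn)

/-- Rescaling t onto the interval of n turns the weight of the transition from n to m into the
length of an overlap. -/
theorem volume_keepCount (ha : 0 < a) (h : ∀ m ≤ k, poissonProb a m ≤ poissonProb b m) {n : ℕ}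
    (hn : k < n) (m : ℕ) :
    poissonMeasure a {n} * (volume.restrict (Set.Ico 0 1)) (keepCount a b k n ⁻¹' {m}) =
      volume (Set.Ico (poissonCdf a n) (poissonCdf a (n + 1)) ∩
        Set.Ico (residualCdf a b k m) (residualCdf a b k (m + 1))) := by
  have hp := poissonProb_pos ha n
  rw [Measure.restrict_apply (measurable_keepCount n (measurableSet_singleton m))]
  have e : keepCount a b k n ⁻¹' {m} ∩ Set.Ico 0 1 =
      (fun t => poissonProb a n * t) ⁻¹' ((fun t => poissonCdf a n + t) ⁻¹'
        (Set.Ico (poissonCdf a n) (poissonCdf a (n + 1)) ∩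
        Set.Ico (residualCdf a b k m) (residualCdf a b k (m + 1)))) := by
    ext t
    have hiff : t ∈ Set.Ico (0 : ℝ) 1 ↔ poissonCdf a n + poissonProb a n * t ∈
        Set.Ico (poissonCdf a n) (poissonCdf a (n + 1)) := by
      refine ⟨poissonCdf_add_mem_Ico ha n, fun ht => ?_⟩
      rw [poissonCdf_succ] at ht
      obtain ⟨h1, h2⟩ := ht
      exact ⟨by by_contra! hlt; linarith [mul_neg_of_pos_of_neg hp hlt],
        by by_contra! hle; linarith [mul_le_mul_of_nonneg_left hle hp.le]⟩
    rw [Set.mem_inter_iff, hiff, and_comm]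
    refine and_congr_right fun ht => ?_
    exact residualQuantile_eq_iff h ((poissonCdf_mono a (show k + 1 ≤ n from hn)).trans ht.1)
      (ht.2.trans_le (poissonCdf_le_one a _))
  rw [e, Real.volume_preimage_mul_left hp.ne', measure_preimage_add, ← mul_assoc,
    ← ofReal_poissonProb, ← ENNReal.ofReal_mul hp.le, abs_of_pos (inv_pos.2 hp),
    mul_inv_cancel₀ hp.ne', ENNReal.ofReal_one, one_mul]

theorem tsum_volume_inter_residual (h : ∀ m ≤ k, poissonProb a m ≤ poissonProb b m) (m : ℕ) :
    ∑' n, volume (Set.Ico (poissonCdf a n) (poissonCdf a (n + 1)) ∩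
        Set.Ico (residualCdf a b k m) (residualCdf a b k (m + 1))) =
      ENNReal.ofReal (poissonProb b m - if m ≤ k then poissonProb a m else 0) := by
  rw [← measure_iUnion]
  · rw [← Set.iUnion_inter, Set.inter_eq_right.2, Real.volume_Ico, residualCdf_succ,
      add_sub_cancel_left]
    intro v hv
    have h1 : v < 1 :=
      hv.2.trans_le ((residualCdf_mono h).ge_of_tendsto (tendsto_residualCdf a b k) _)
    have h0 : 0 ≤ v := by
      refine le_trans ?_ ((residualCdf_mono h (Nat.zero_le m)).trans hv.1)
      rw [residualCdf_zero]
      exact Finset.sum_nonneg fun _ _ => poissonProb_nonneg _ _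
    have hex : ∃ n, v < poissonCdf a (n + 1) :=
      (((tendsto_poissonCdf a).comp (Filter.tendsto_add_atTop_nat 1)).eventually
        (lt_mem_nhds h1)).exists
    classical
    refine Set.mem_iUnion.2 ⟨Nat.find hex, ?_, Nat.find_spec hex⟩
    cases hn : Nat.find hex with
    | zero => simpa [poissonCdf] using h0
    | succ n => exact not_lt.1 (Nat.find_min hex (by omega))
  · intro i j hij
    exact ((poissonCdf_mono a).pairwise_disjoint_on_Ico_succ hij).mono
      Set.inter_subset_left Set.inter_subset_left
  · exact fun n => measurableSet_Ico.inter measurableSet_Ico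

end Quantile

/-! ### The thinning and its law. -/

namespace SimplePointMeasure

variable (a b : ℝ≥0) (k : ℕ)

/-- The number of thinning steps. -/
noncomputable def stepCount (ν : SimplePointMeasure Circle) : ℕ :=
  if ν.count Set.univ ≤ k then 0
  else ν.count Set.univ - keepCount a b k (ν.count Set.univ) (Circle.turn (mark ν))

/-- Thin configurations with more than `k` points, using the mark to choose the number of points to
keep. -/
noncomputable def thinning (ν : SimplePointMeasure Circle) : SimplePointMeasure Circle :=
  thin^[stepCount a b k ν] ν

theorem measurable_stepCount : Measurable (stepCount a b k) := by
  have hN : Measurable fun ν : SimplePointMeasure Circle => ν.count Set.univ :=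
    measurable_count .univ
  have hk : Measurable fun p : ℕ × Circle => keepCount a b k p.1 (Circle.turn p.2) :=
    measurable_from_prod_countable_right fun n =>
      (measurable_keepCount n).comp Circle.measurable_turn
  have h2 : Measurable fun p : ℕ × ℕ => p.1 - p.2 := .of_discrete
  have h3 := hk.comp (hN.prodMk measurable_mark)
  have h4 := h2.comp (hN.prodMk h3)
  exact Measurable.ite (measurableSet_le hN measurable_const) measurable_const h4

theorem measurable_thinning : Measurable (thinning a b k) := by
  have h : Measurable fun p : ℕ × SimplePointMeasure Circle => thin^[p.1] p.2 :=
    measurable_from_prod_countable_right fun n => measurable_thin.iterate n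
  exact h.comp ((measurable_stepCount a b k).prodMk measurable_id)

theorem isRotationEquivariant_thinning : IsRotationEquivariant (thinning a b k) := by
  intro ν θ
  rw [thinning, thinning, rotate_iterate_thin]
  congr 1
  rw [stepCount, stepCount, count_univ_rotate, mark_rotate]

theorem points_thinning_subset (ν : SimplePointMeasure Circle) :
    (thinning a b k ν).points ⊆ ν.points := points_iterate_thin_subset _ _

variable {a b k} (U : Measure Circle) [U.IsHaarMeasure] [IsProbabilityMeasure U]

theorem map_thinning_binomialLaw_of_le {n : ℕ} (hn : n ≤ k) :
    (binomialLaw U n).map (thinning a b k) = binomialLaw U n := by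
  conv_rhs => rw [← Measure.map_id (μ := binomialLaw U n)]
  refine Measure.map_congr ?_
  filter_upwards [ae_count_univ_binomialLaw (U := U) n] with ν hν
  simp [thinning, stepCount, hν, hn]

theorem map_thinning_binomialLaw_of_lt (hb : 0 < b) (hab : b < a)
    (hcdf : poissonCdf a (k + 2) ≤ poissonCdf b (k + 1)) {n : ℕ} (hn : k < n)
    {s : Set (SimplePointMeasure Circle)} (hs : MeasurableSet s) :
    (binomialLaw U n).map (thinning a b k) s =
      ∑' m, (volume.restrict (Set.Ico 0 1)) (keepCount a b k n ⁻¹' {m}) *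
        binomialLaw U m s := by
  have hlt : ∀ z, keepCount a b k n (Circle.turn z) < n := fun z =>
    keepCount_lt hb hab hcdf hn ⟨Circle.turn_nonneg z, Circle.turn_lt_one z⟩
  have hkm : Measurable fun z => keepCount a b k n (Circle.turn z) :=
    (measurable_keepCount n).comp Circle.measurable_turn
  have hrhs : ∑' m, (volume.restrict (Set.Ico 0 1)) (keepCount a b k n ⁻¹' {m}) *
      binomialLaw U m s = ∫⁻ z, binomialLaw U (keepCount a b k n (Circle.turn z)) s ∂U := by
    rw [← lintegral_map (f := fun m => binomialLaw U m s) .of_discrete hkm, lintegral_countable']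
    refine tsum_congr fun m => ?_
    rw [mul_comm, ← map_turn U, Measure.map_apply Circle.measurable_turn
      (measurable_keepCount n (measurableSet_singleton m)),
      Measure.map_apply hkm (measurableSet_singleton m)]
    rfl
  rw [hrhs]
  obtain ⟨n, rfl⟩ := Nat.exists_eq_succ_of_ne_zero (Nat.ne_zero_of_lt hn)
  rw [Nat.succ_eq_add_one] at *
  -- The first deletion releases the mark; `g` performs the remaining ones on survivors independent
  -- of it.
  let g : SimplePointMeasure Circle × Circle → SimplePointMeasure Circle := fun p =>
    thin^[n - keepCount a b k (n + 1) (Circle.turn p.2)] p.1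
  have hg : Measurable g := by
    have h : Measurable fun p : ℕ × SimplePointMeasure Circle => thin^[p.1] p.2 :=
      measurable_from_prod_countable_right fun n => measurable_thin.iterate n
    have h1 : Measurable fun p : SimplePointMeasure Circle × Circle =>
        n - keepCount a b k (n + 1) (Circle.turn p.2) :=
      (Measurable.of_discrete (f := fun m => n - m)).comp (hkm.comp measurable_snd)
    exact h.comp (h1.prodMk measurable_fst)
  have hmap : (binomialLaw U (n + 1)).map (thinning a b k) =
      ((binomialLaw U (n + 1)).map fun ν => (thin ν, mark ν)).map g := by
    rw [Measure.map_map hg (measurable_thin.prodMk measurable_mark)]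
    refine Measure.map_congr ?_
    filter_upwards [ae_count_univ_binomialLaw (U := U) (n + 1)] with ν hν
    have h1 : stepCount a b k ν =
        (n - keepCount a b k (n + 1) (Circle.turn (mark ν))) + 1 := by
      have := hlt (mark ν)
      rw [stepCount, hν, if_neg (not_le.2 hn)]
      omega
    rw [thinning, h1, Function.iterate_succ_apply]
    rfl
  have hfib : ∀ z, (binomialLaw U n) {ν | g (ν, z) ∈ s} =
      binomialLaw U (keepCount a b k (n + 1) (Circle.turn z)) s := by
    intro z
    have h1 := Nat.le_of_lt_succ (hlt z)
    have h2 := map_iterate_thin_binomialLaw U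
      (k := keepCount a b k (n + 1) (Circle.turn z))
      (n - keepCount a b k (n + 1) (Circle.turn z))
    rw [Nat.add_sub_cancel' h1] at h2
    conv_rhs => rw [← h2, Measure.map_apply (measurable_thin.iterate _) hs]
    rfl
  rw [hmap]
  -- A single initial point has a constant mark, but then nothing is kept whatever the mark.
  rcases Nat.eq_zero_or_pos n with rfl | hpos
  · have h0 : ∀ z, keepCount a b k 1 (Circle.turn z) = 0 := fun z => Nat.lt_one_iff.1 (hlt z)
    have hg0 : g = Prod.fst := by
      ext1 p
      simp [g]
    rw [hg0, Measure.map_map measurable_fst (measurable_thin.prodMk measurable_mark)]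
    simp only [zero_add, h0, lintegral_const, measure_univ, mul_one]
    rw [← map_thin_binomialLaw U (k := 0)]
    rfl
  · rw [map_thin_mark_binomialLaw U hpos.ne', Measure.map_apply hg hs,
      Measure.prod_apply_symm (hg hs)]
    exact lintegral_congr fun z => hfib z

theorem map_thinning_poissonMixture (hb : 0 < b) (hab : b < a)
    (hprob : poissonProb a k ≤ poissonProb b k)
    (hcdf : poissonCdf a (k + 2) ≤ poissonCdf b (k + 1)) :
    (poissonMixture U a).map (thinning a b k) = poissonMixture U b := by
  have hle : ∀ m ≤ k, poissonProb a m ≤ poissonProb b m := fun m hm =>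
    poissonProb_le_of_le hab hm hprob
  have ha := hb.trans hab
  ext s hs
  rw [Measure.map_apply (measurable_thinning a b k) hs, poissonMixture,
    Measure.sum_apply _ (measurable_thinning a b k hs), poissonMixture, Measure.sum_apply _ hs]
  have h1 : ∀ n, (poissonMeasure a {n} • binomialLaw U n) (thinning a b k ⁻¹' s) =
      ∑' m, ((if m = n ∧ m ≤ k then poissonMeasure a {m} else 0) +
        volume (Set.Ico (poissonCdf a n) (poissonCdf a (n + 1)) ∩
        Set.Ico (residualCdf a b k m) (residualCdf a b k (m + 1)))) * binomialLaw U m s := by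
    intro n
    rw [Measure.smul_apply, ← Measure.map_apply (measurable_thinning a b k) hs, smul_eq_mul]
    rcases le_or_gt n k with hn | hn
    · have hempty : ∀ m, Set.Ico (poissonCdf a n) (poissonCdf a (n + 1)) ∩
          Set.Ico (residualCdf a b k m) (residualCdf a b k (m + 1)) = ∅ := by
        intro m
        refine Set.disjoint_iff_inter_eq_empty.1 (Set.Ico_disjoint_Ico.2 ?_)
        refine (min_le_left _ _).trans (le_trans ?_ (le_max_right _ _))
        exact (poissonCdf_mono a (show n + 1 ≤ k + 1 by omega)).trans
          ((residualCdf_zero a b k).symm.le.trans (residualCdf_mono hle (Nat.zero_le m)))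
      simp only [hempty, measure_empty, add_zero]
      rw [map_thinning_binomialLaw_of_le U hn, tsum_eq_single n]
      · simp [hn]
      · intro m hm
        rw [if_neg fun h => hm h.1, zero_mul]
    · rw [map_thinning_binomialLaw_of_lt U hb hab hcdf hn hs, ← ENNReal.tsum_mul_left]
      refine tsum_congr fun m => ?_
      rw [← mul_assoc, volume_keepCount ha hle hn, if_neg (by omega), zero_add]
  simp only [h1]
  rw [ENNReal.tsum_comm]
  refine tsum_congr fun m => ?_
  rw [ENNReal.tsum_mul_right, ENNReal.tsum_add, tsum_volume_inter_residual hle,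
    Measure.smul_apply, smul_eq_mul, ← ofReal_poissonProb b]
  congr 1
  rw [tsum_eq_single m (fun n hn => if_neg fun h => hn h.1.symm)]
  by_cases hm : m ≤ k
  · simp only [hm, and_self, if_true]
    rw [← ofReal_poissonProb, ← ENNReal.ofReal_add (poissonProb_nonneg _ _)
      (sub_nonneg.2 (hle m hm)), add_sub_cancel]
  · simp [hm]

end SimplePointMeasure

/-! ### Assembly of the equivalences. -/

theorem measure_eq_of_hasLaw_poisson {Ω : Type*} [MeasurableSpace Ω] {Q : Measure Ω} {X : Ω → ℕ}
    {a : ℝ≥0} (hX : HasLaw X (poissonMeasure a) Q) (k : ℕ) :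
    Q {ω | X ω = k} = ENNReal.ofReal (poissonProb a k) := by
  rw [ofReal_poissonProb, ← hX.map_eq, Measure.map_apply_of_aemeasurable hX.aemeasurable
    (measurableSet_singleton k)]
  rfl

theorem measure_le_of_hasLaw_poisson {Ω : Type*} [MeasurableSpace Ω] {Q : Measure Ω} {X : Ω → ℕ}
    {a : ℝ≥0} (hX : HasLaw X (poissonMeasure a) Q) (k : ℕ) :
    Q {ω | X ω ≤ k} = ENNReal.ofReal (poissonCdf a (k + 1)) := by
  rw [← poissonMeasure_real_Iio, Measure.real, ENNReal.ofReal_toReal (measure_ne_top _ _),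
    ← hX.map_eq, Measure.map_apply_of_aemeasurable hX.aemeasurable measurableSet_Iio]
  congr 1
  ext ω
  simp

/-- `σ` ranges over all normalizations of the uniform measure on the circle: the nonzero finite
rotation-invariant Borel measures. -/
theorem mainTheorem6
    (σ : Measure Circle) [σ.IsHaarMeasure]
    (lam mu : ℝ≥0) (hmu : 0 < mu) (hlam : mu < lam)
    {Ω : Type*} [MeasurableSpace Ω] (P : Measure Ω) [IsProbabilityMeasure P]
    (ξ : Ω → SimplePointMeasure Circle) (hξ : IsPoissonProcess P (lam • σ) ξ)
    {Ω' : Type*} [MeasurableSpace Ω'] (Q : Measure Ω') [IsProbabilityMeasure Q]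
    (X Y : Ω' → ℕ)
    (hX : HasLaw X (poissonMeasure (lam * (σ Set.univ).toNNReal)) Q)
    (hY : HasLaw Y (poissonMeasure (mu * (σ Set.univ).toNNReal)) Q) :
    List.TFAE [
      ∃ f : SimplePointMeasure Circle → SimplePointMeasure Circle,
        Measurable f ∧ IsRotationEquivariant f ∧
        IsPoissonProcess P (mu • σ) (fun ω => f (ξ ω)) ∧
        ∀ᵐ ω ∂P, (f (ξ ω)).points ⊆ (ξ ω).points,
      ∃ k : ℕ, Q {ω | X ω = k} ≤ Q {ω | Y ω = k} ∧
        Q {ω | X ω ≤ k + 1} ≤ Q {ω | Y ω ≤ k},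
      ¬ ∃ k : ℕ, Q {ω | X ω = k + 1} > Q {ω | Y ω = k + 1} ∧
        Q {ω | X ω ≤ k + 1} > Q {ω | Y ω ≤ k}] := by
  have hσ0 : σ Set.univ ≠ 0 := isOpen_univ.measure_ne_zero σ Set.univ_nonempty
  have hσt : σ Set.univ ≠ ∞ := measure_ne_top _ _
  -- Normalizing `σ` moves its total mass into the Poisson parameters.
  set U : Measure Circle := (σ Set.univ)⁻¹ • σ with hU
  have hUh : U.IsHaarMeasure :=
    Measure.IsHaarMeasure.smul σ (ENNReal.inv_ne_zero.2 hσt) (ENNReal.inv_ne_top.2 hσ0)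
  have hUp : IsProbabilityMeasure U := ⟨by simp [hU]⟩
  have hscale : ∀ c : ℝ≥0, c • σ = (c * (σ Set.univ).toNNReal) • U := fun c => by
    rw [hU, mul_smul]
    congr 1
    rw [ENNReal.smul_def, ENNReal.coe_toNNReal hσt, smul_smul, ENNReal.mul_inv_cancel hσ0 hσt,
      one_smul]
  have hσpos : 0 < (σ Set.univ).toNNReal := ENNReal.toNNReal_pos hσ0 hσt
  set a := lam * (σ Set.univ).toNNReal with ha
  set b := mu * (σ Set.univ).toNNReal with hb
  have hb0 : 0 < b := mul_pos hmu hσpos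
  have hab : b < a := mul_lt_mul_of_pos_right hlam hσpos
  have hcdf0 : ∀ (c : ℝ≥0) n, 0 ≤ poissonCdf c n := fun c n =>
    Finset.sum_nonneg fun _ _ => poissonProb_nonneg _ _
  simp only [measure_eq_of_hasLaw_poisson hX, measure_eq_of_hasLaw_poisson hY,
    measure_le_of_hasLaw_poisson hX, measure_le_of_hasLaw_poisson hY, gt_iff_lt, ← not_le,
    ENNReal.ofReal_le_ofReal_iff (poissonProb_nonneg _ _),
    ENNReal.ofReal_le_ofReal_iff (hcdf0 _ _)]
  have h23 := exists_poissonProb_le_iff hb0 hab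
  simp only [← not_le] at h23
  tfae_have 2 ↔ 3 := h23
  tfae_have 1 → 3 := by
    rintro ⟨f, hf, -, hfξ, hsub⟩
    simpa only [← not_le] using hξ.not_exists_of_thinning (hscale lam) (hscale mu) hf hfξ hsub
  tfae_have 2 → 1 := by
    rintro ⟨k, hk, hk'⟩
    have hm := SimplePointMeasure.measurable_thinning a b k
    refine ⟨SimplePointMeasure.thinning a b k, hm,
      SimplePointMeasure.isRotationEquivariant_thinning a b k,
      isPoissonProcess_of_map_eq (hscale mu) (hm.comp hξ.measurable) ?_,
      Filter.Eventually.of_forall fun ω => SimplePointMeasure.points_thinning_subset a b k _⟩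
    rw [← SimplePointMeasure.map_thinning_poissonMixture U hb0 hab hk hk',
      ← hξ.map_eq_poissonMixture (hscale lam), Measure.map_map hm hξ.measurable]
    rfl
  tfae_finish
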